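/- Let $n\ge 1$. There is a constant $c_n$, depending only on $n$, such that the following holds. Let $A$ be a (possibly unbounded) self-adjoint operator with domain $D(A)$ in a complex Hilbert space $H$, let $B$ be a bounded self-adjoint operator on $H$, and let $f\in\mathcal B_n$, that is, $f:\mathbb R\to\mathbb C$ is smooth and bounded and $$\int_{\mathbb R}|\hat f(s)|\,|s|^k\,ds<\infty\qquad(1\le k\le n).$$ Here $\hat f$ is the Fourier transform in the sense of distributions, normalized by $f(x)=\int \hat f(s)e^{isx}\,ds$; it is required to be given by a locally integrable function $\hat f(s)$ on $\mathbb R\setminus\{0\}$ (so that a singularity at $s=0$ is allowed). The operators $f(A)$, $f^{(k)}(A)$, $e^{isA}$ are defined by the functional calculus of $A$. For a bounded operator $S$ the commutator $[S,A]=SA-AS$ is the form $\langle\varphi,[S,A]\psi\rangle=\langle\varphi,SA\psi\rangle-\langle A\varphi,S\psi\rangle$ on $D(A)\times D(A)$, and it is called bounded if it is the form of a (necessarily unique) bounded operator, again denoted $[S,A]$. Put $\mathrm{ad}_A^{(0)}(B)=B$ and $\mathrm{ad}_A^{(k)}(B)=[\mathrm{ad}_A^{(k-1)}(B),A]$. 1.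 One has $$[B,f(A)]=i\int_{\mathbb R}\hat f(s)\int_0^s e^{i(s-u)A}[B,A]e^{iuA}\,du\,ds$$ in the sense of forms on $D(A)$: for $\varphi,\psi\in D(A)$, the vectors $e^{itA}\varphi$, $e^{itA}\psi$ lie in $D(A)$ for all $t\in\mathbb R$, and $\langle\varphi,[B,f(A)]\psi\rangle=i\int\hat f(s)\int_0^s\langle e^{-i(s-u)A}\varphi,[B,A]e^{iuA}\psi\rangle\,du\,ds$ with absolutely convergent integrals. If $[B,A]$ is bounded, the identity also holds as an identity of operators when applied to any $\psi\in H$, with absolutely convergent ($H$-valued) integrals. 2. If $\mathrm{ad}_A^{(k)}(B)$ is bounded for $1\le k\le n$, then there are bounded operators $R_n,R_n'$ with $$[B,f(A)]=\sum_{k=1}^{n-1}\frac1{k!}f^{(k)}(A)\,\mathrm{ad}_A^{(k)}(B)+R_n,$$ $$[B,f(A)]=\sum_{k=1}^{n-1}\frac{(-1)^{k-1}}{k!}\,\mathrm{ad}_A^{(k)}(B)\,f^{(k)}(A)-(R_n')^*,$$ $$\max(\|R_n\|,\|R_n'\|)\le c_n\,\|\mathrm{ad}_A^{(n)}(B)\|\int_{\mathbb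 R}|\hat f(s)|\,|s|^n\,ds,$$ and $R_n'=R_n$ if $f$ is real-valued. -/

import Mathlib

open MeasureTheory Filter Topology
open scoped ContDiff

universe u

namespace CommutatorExpansion

noncomputable section

/-! ### Bounded functional calculus of an unbounded self-adjoint operator -/

section FunctionalCalculus

variable {H : Type*} [NormedAddCommGroup H] [InnerProductSpace ℂ H] [CompleteSpace H]

set_option linter.unusedSectionVars false

/-- The operator `A + c`, as a linear map on the domain of `A`. -/
def addScalar (A : H →ₗ.[ℂ] H) (c : ℂ) : A.domain →ₗ[ℂ] H :=
  A.toFun + c • A.domain.subtype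

/-- The bounded inverse `(A + c)⁻¹ : H → H` of `A + c`: the continuous extension to `H` of the map
`(A + c) ψ ↦ ψ`. It is the inverse for self-adjoint `A` and `c = ± i`, see `resolvent_spec`. -/
def resolventAt (A : H →ₗ.[ℂ] H) (c : ℂ) : H →L[ℂ] H :=
  A.domain.subtype.extendOfNorm (addScalar A c)

/-- The function `z ↦ z * f (Re (1 / z))`. At the point `z = 1 / (x + i)`, `x` real, its value is
`f x / (x + i)`; at `z = 0`, the point that corresponds to `x = ± ∞`, its value is `0`. -/
def resolventSymbol (f : ℝ → ℂ) (z : ℂ) : ℂ := z * f (z⁻¹).re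

/-- The operator `f(A)`, for `A` self-adjoint and `f` bounded and continuous on the real line: it is
the bounded operator determined by `f(A) (A + i)⁻¹ = g(A)` with `g x = f x / (x + i)`. The function
`g` vanishes at infinity and `g(A)` is given by the continuous functional calculus of the bounded
normal operator `(A + i)⁻¹`; see `funcCalc_comp_resolvent` and `funcCalc_unique`. -/
def funcCalc (A : H →ₗ.[ℂ] H) (f : ℝ → ℂ) : H →L[ℂ] H :=
  (cfc (resolventSymbol f) (resolventAt A Complex.I)).toLinearMap.extendOfNorm
    (resolventAt A Complex.I).toLinearMap

/-- The unitary operator `exp (i s A)`. -/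
def expI (A : H →ₗ.[ℂ] H) (s : ℝ) : H →L[ℂ] H :=
  funcCalc A (fun x => Complex.exp (Complex.I * s * x))

theorem symm_apply {A : H →ₗ.[ℂ] H} (hA : IsSelfAdjoint A) (x y : A.domain) :
    inner ℂ (A x) (y : H) = inner ℂ (x : H) (A y) := by
  have h := LinearPMap.adjoint_isFormalAdjoint hA.dense_domain
  rw [LinearPMap.isSelfAdjoint_def.mp hA] at h
  exact h x y

/-- A self-adjoint operator is maximal: a vector in the domain of the adjoint is in the domain. -/
theorem mem_domain_of_inner {A : H →ₗ.[ℂ] H} (hA : IsSelfAdjoint A) (y w : H)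
    (h : ∀ x : A.domain, inner ℂ w (x : H) = inner ℂ y (A x)) :
    ∃ hy : y ∈ A.domain, A ⟨y, hy⟩ = w := by
  have hd : y ∈ A.domain := by
    have h1 : y ∈ A.adjoint.domain := LinearPMap.mem_adjoint_domain_of_exists y ⟨w, h⟩
    rwa [LinearPMap.isSelfAdjoint_def.mp hA] at h1
  refine ⟨hd, ?_⟩
  refine hA.dense_domain.eq_of_inner_left ℂ fun v hv => ?_
  rw [h ⟨v, hv⟩]
  exact symm_apply hA ⟨y, hd⟩ ⟨v, hv⟩

theorem addScalar_apply (A : H →ₗ.[ℂ] H) (c : ℂ) (x : A.domain) :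
    addScalar A c x = A x + c • (x : H) := rfl

theorem norm_le_addScalar {A : H →ₗ.[ℂ] H} (hA : IsSelfAdjoint A) {c : ℂ}
    (hc : c = Complex.I ∨ c = -Complex.I) (x : A.domain) :
    ‖(x : H)‖ ≤ 1 * ‖addScalar A c x‖ := by
  have him : (inner ℂ (x : H) (A x)).im = 0 := by
    have h1 := symm_apply hA x x
    rw [← inner_conj_symm] at h1
    exact Complex.conj_eq_iff_im.mp h1
  have h2 : (inner ℂ (x : H) (addScalar A c x)).im = c.im * ‖(x : H)‖ ^ 2 := by
    rw [addScalar_apply, inner_add_right, inner_smul_right, inner_self_eq_norm_sq_to_K]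
    rcases hc with rfl | rfl <;> simp [him, ← Complex.ofReal_pow]
  have h3 : |(inner ℂ (x : H) (addScalar A c x)).im| ≤ ‖(x : H)‖ * ‖addScalar A c x‖ :=
    (Complex.abs_im_le_norm _).trans (norm_inner_le_norm _ _)
  have h4 : |c.im| = 1 := by rcases hc with rfl | rfl <;> simp
  rw [h2, abs_mul, h4, one_mul, abs_of_nonneg (sq_nonneg _)] at h3
  rcases (norm_nonneg (x : H)).eq_or_lt with h0 | h0
  · rw [← h0]; positivity
  · rw [one_mul]; nlinarith

theorem denseRange_addScalar {A : H →ₗ.[ℂ] H} (hA : IsSelfAdjoint A) {c : ℂ}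
    (hc : c = Complex.I ∨ c = -Complex.I) : DenseRange (addScalar A c) := by
  have key : (LinearMap.range (addScalar A c))ᗮ = ⊥ := by
    rw [Submodule.eq_bot_iff]
    intro y hy
    rw [Submodule.mem_orthogonal'] at hy
    have h1 : ∀ x : A.domain, inner ℂ (-(starRingEnd ℂ c • y)) (x : H) = inner ℂ y (A x) := by
      intro x
      have := hy (addScalar A c x) ⟨x, rfl⟩
      rw [addScalar_apply, inner_add_right, inner_smul_right] at this
      rw [inner_neg_left, inner_smul_left, Complex.conj_conj]
      linear_combination -this
    obtain ⟨hd, hAy⟩ := mem_domain_of_inner hA y _ h1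
    have hc' : starRingEnd ℂ c = Complex.I ∨ starRingEnd ℂ c = -Complex.I := by
      rcases hc with rfl | rfl <;> simp
    have h2 := norm_le_addScalar hA hc' ⟨y, hd⟩
    rw [addScalar_apply, hAy] at h2
    simpa using h2
  have h := Submodule.topologicalClosure_eq_top_iff.mpr key
  rw [← Submodule.dense_iff_topologicalClosure_eq_top] at h
  exact h

theorem resolvent_addScalar {A : H →ₗ.[ℂ] H} (hA : IsSelfAdjoint A) {c : ℂ}
    (hc : c = Complex.I ∨ c = -Complex.I) (x : A.domain) :
    resolventAt A c (addScalar A c x) = x :=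
  LinearMap.extendOfNorm_eq (denseRange_addScalar hA hc) ⟨1, norm_le_addScalar hA hc⟩ x

/-- The operator `resolventAt A c` is the inverse of `A + c` for `c = ± i`. -/
theorem resolvent_spec {A : H →ₗ.[ℂ] H} (hA : IsSelfAdjoint A) {c : ℂ}
    (hc : c = Complex.I ∨ c = -Complex.I) (y : H) :
    ∃ h : resolventAt A c y ∈ A.domain, A ⟨resolventAt A c y, h⟩ + c • resolventAt A c y = y := by
  have h1 : ∀ z : A.domain,
      inner ℂ (y - c • resolventAt A c y) (z : H) = inner ℂ (resolventAt A c y) (A z) := by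
    intro z
    refine (denseRange_addScalar hA hc).induction_on
      (p := fun y => inner ℂ (y - c • resolventAt A c y) (z : H) = inner ℂ (resolventAt A c y) (A z))
      y ?_ ?_
    · exact isClosed_eq (by fun_prop) (by fun_prop)
    · intro x
      rw [resolvent_addScalar hA hc, addScalar_apply, add_sub_cancel_right]
      exact symm_apply hA x z
  obtain ⟨hd, h2⟩ := mem_domain_of_inner hA _ _ h1
  exact ⟨hd, by rw [h2, sub_add_cancel]⟩

theorem denseRange_resolvent {A : H →ₗ.[ℂ] H} (hA : IsSelfAdjoint A) {c : ℂ}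
    (hc : c = Complex.I ∨ c = -Complex.I) : DenseRange (resolventAt A c) := by
  refine hA.dense_domain.mono ?_
  intro x hx
  exact ⟨addScalar A c ⟨x, hx⟩, resolvent_addScalar hA hc ⟨x, hx⟩⟩

theorem adjoint_resolvent {A : H →ₗ.[ℂ] H} (hA : IsSelfAdjoint A) :
    star (resolventAt A Complex.I) = resolventAt A (-Complex.I) := by
  rw [ContinuousLinearMap.star_eq_adjoint]
  symm
  rw [ContinuousLinearMap.eq_adjoint_iff]
  intro x y
  obtain ⟨hx, ex⟩ := resolvent_spec hA (Or.inr rfl) x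
  obtain ⟨hy, ey⟩ := resolvent_spec hA (Or.inl rfl) y
  have h := symm_apply hA ⟨_, hx⟩ ⟨_, hy⟩
  conv_lhs => rw [← ey]
  conv_rhs => rw [← ex]
  rw [inner_add_right, inner_add_left, inner_smul_left, inner_smul_right, h]
  simp

/-- The resolvent `(A + i)⁻¹` is normal, so that its continuous functional calculus makes sense. -/
theorem isStarNormal_resolvent {A : H →ₗ.[ℂ] H} (hA : IsSelfAdjoint A) :
    IsStarNormal (resolventAt A Complex.I) := by
  have aux : ∀ {c d : ℂ}, (c = Complex.I ∨ c = -Complex.I) → (d = Complex.I ∨ d = -Complex.I) →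
      ∀ x, resolventAt A c x - resolventAt A d x = (d - c) • resolventAt A c (resolventAt A d x) := by
    intro c d hc hd x
    obtain ⟨h, e⟩ := resolvent_spec hA hd x
    have h1 := resolvent_addScalar hA hc ⟨_, h⟩
    rw [addScalar_apply] at h1
    have h2 : A ⟨resolventAt A d x, h⟩ + c • resolventAt A d x = x - (d - c) • resolventAt A d x := by
      rw [eq_sub_of_add_eq e, sub_smul]
      abel
    rw [h2, map_sub, map_smul] at h1
    exact sub_eq_iff_eq_add.mpr (sub_eq_iff_eq_add'.mp h1)
  refine ⟨?_⟩
  rw [adjoint_resolvent hA]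
  ext x
  have h1 := aux (Or.inl rfl) (Or.inr rfl) x
  have h2 := aux (Or.inr rfl) (Or.inl rfl) x
  rw [← neg_sub, h2, ← neg_smul, neg_sub] at h1
  have h0 : -Complex.I - Complex.I ≠ 0 := fun h => by
    have := congrArg Complex.im h
    norm_num at this
  exact smul_right_injective H h0 h1

theorem continuous_resolventSymbol {f : ℝ → ℂ} (hf : Continuous f) {C : ℝ}
    (hC : ∀ x, ‖f x‖ ≤ C) : Continuous (resolventSymbol f) := by
  rw [continuous_iff_continuousAt]
  intro z
  unfold resolventSymbol
  rcases eq_or_ne z 0 with rfl | hz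
  · rw [ContinuousAt, zero_mul]
    refine squeeze_zero_norm (a := fun z => ‖z‖ * C) (fun z => ?_) ?_
    · rw [norm_mul]; gcongr; exact hC _
    · have : Continuous fun z : ℂ => ‖z‖ * C := by fun_prop
      simpa using this.tendsto 0
  · have h1 : ContinuousAt (fun z : ℂ => (z⁻¹).re) z :=
      Complex.continuous_re.continuousAt.comp (continuousAt_inv₀ hz)
    exact continuousAt_id.mul (hf.continuousAt.comp h1)

theorem norm_cfc_resolventSymbol_le {A : H →ₗ.[ℂ] H} (hA : IsSelfAdjoint A) {f : ℝ → ℂ}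
    (hf : Continuous f) {C : ℝ} (hC : ∀ x, ‖f x‖ ≤ C) (x : H) :
    ‖cfc (resolventSymbol f) (resolventAt A Complex.I) x‖ ≤ C * ‖resolventAt A Complex.I x‖ := by
  have hC0 : 0 ≤ C := (norm_nonneg _).trans (hC 0)
  have hN := isStarNormal_resolvent hA
  set T := resolventAt A Complex.I
  set g : ℝ → ℂ := fun x => (Real.sqrt (C ^ 2 - ‖f x‖ ^ 2) : ℝ) with hg
  have hgc : Continuous g := by fun_prop
  have hgC : ∀ x, ‖g x‖ ≤ C := by
    intro x
    rw [hg, Complex.norm_real, Real.norm_of_nonneg (Real.sqrt_nonneg _)]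
    refine Real.sqrt_le_iff.mpr ⟨hC0, ?_⟩
    nlinarith [sq_nonneg ‖f x‖]
  have hk := continuous_resolventSymbol hf hC
  have hm := continuous_resolventSymbol hgc hgC
  have hpt : ∀ z : ℂ, star (resolventSymbol f z) * resolventSymbol f z
      + star (resolventSymbol g z) * resolventSymbol g z = ((C ^ 2 : ℝ) : ℂ) * (star z * z) := by
    intro z
    have h0 : 0 ≤ C ^ 2 - ‖f (z⁻¹).re‖ ^ 2 := by
      nlinarith [hC (z⁻¹).re, norm_nonneg (f (z⁻¹).re)]
    have h1 : ∀ w : ℂ, star w * w = ((‖w‖ ^ 2 : ℝ) : ℂ) := fun w => by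
      rw [Complex.star_def, Complex.conj_mul']; push_cast; rfl
    simp only [h1, resolventSymbol, norm_mul, ← Complex.ofReal_mul, ← Complex.ofReal_add]
    rw [hg, Complex.norm_real, mul_pow, mul_pow, Real.norm_of_nonneg (Real.sqrt_nonneg _),
      Real.sq_sqrt h0]
    congr 1; ring
  have hop : star (cfc (resolventSymbol f) T) * cfc (resolventSymbol f) T
      + star (cfc (resolventSymbol g) T) * cfc (resolventSymbol g) T
      = ((C ^ 2 : ℝ) : ℂ) • (star T * T) := by
    rw [← cfc_star, ← cfc_star, ← cfc_mul .., ← cfc_mul .., ← cfc_add ..]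
    simp only [hpt]
    rw [cfc_const_mul .., cfc_mul .., cfc_star, cfc_id' ℂ T]
  have hnorm : ∀ S : H →L[ℂ] H, inner ℂ x ((star S * S) x) = ((‖S x‖ ^ 2 : ℝ) : ℂ) := by
    intro S
    rw [mul_apply_eq_comp, ContinuousLinearMap.star_eq_adjoint,
      ContinuousLinearMap.adjoint_inner_right, inner_self_eq_norm_sq_to_K]
    push_cast; rfl
  have h := congrArg (fun S : H →L[ℂ] H => inner ℂ x (S x)) hop
  simp only [add_apply, smul_apply, inner_add_right,
    inner_smul_right, hnorm, ← Complex.ofReal_mul, ← Complex.ofReal_add] at h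
  have h' := Complex.ofReal_injective h
  refine abs_le_of_sq_le_sq' ?_ (by positivity) |>.2
  nlinarith [sq_nonneg ‖cfc (resolventSymbol g) T x‖]

/-- The defining property of `f(A)`. -/
theorem funcCalc_comp_resolvent {A : H →ₗ.[ℂ] H} (hA : IsSelfAdjoint A) {f : ℝ → ℂ}
    (hf : Continuous f) {C : ℝ} (hC : ∀ x, ‖f x‖ ≤ C) :
    funcCalc A f ∘L resolventAt A Complex.I
      = cfc (resolventSymbol f) (resolventAt A Complex.I) := by
  ext x
  exact LinearMap.extendOfNorm_eq (denseRange_resolvent hA (Or.inl rfl))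
    ⟨C, norm_cfc_resolventSymbol_le hA hf hC⟩ x

theorem funcCalc_unique {A : H →ₗ.[ℂ] H} (hA : IsSelfAdjoint A) {f : ℝ → ℂ}
    (hf : Continuous f) {C : ℝ} (hC : ∀ x, ‖f x‖ ≤ C) (T : H →L[ℂ] H)
    (hT : T ∘L resolventAt A Complex.I = cfc (resolventSymbol f) (resolventAt A Complex.I)) :
    T = funcCalc A f := by
  rw [← funcCalc_comp_resolvent hA hf hC] at hT
  have h := (denseRange_resolvent hA (Or.inl rfl)).equalizer T.continuous
    (funcCalc A f).continuous (funext fun x => DFunLike.congr_fun hT x)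
  exact DFunLike.coe_injective h

end FunctionalCalculus

/-! ### Commutators with an unbounded operator -/

section Commutators

variable {H : Type*} [NormedAddCommGroup H] [InnerProductSpace ℂ H]

/-- The commutator `[S, A] = S A - A S` of a bounded operator `S` with the self-adjoint operator
`A`, as a sesquilinear form on the domain of `A`. -/
def commForm (A : H →ₗ.[ℂ] H) (S : H →L[ℂ] H) (φ ψ : A.domain) : ℂ :=
  inner ℂ (φ : H) (S (A ψ)) - inner ℂ (A φ) (S (ψ : H))

/-- The bounded operator `T` is the commutator `[S, A]`. -/
def IsCommutator (A : H →ₗ.[ℂ] H) (S T : H →L[ℂ] H) : Prop :=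
  ∀ φ ψ : A.domain, inner ℂ (φ : H) (T ψ) = commForm A S φ ψ

open Classical in
/-- The commutator `[S, A]` as a bounded operator, if it is one (and `0` by convention if not). -/
def bddCommutator (A : H →ₗ.[ℂ] H) (S : H →L[ℂ] H) : H →L[ℂ] H :=
  if h : ∃ T, IsCommutator A S T then h.choose else 0

/-- The iterated commutators: `ad A B 0 = B` and `ad A B (k + 1) = [ad A B k, A]`. -/
def ad (A : H →ₗ.[ℂ] H) (B : H →L[ℂ] H) : ℕ → (H →L[ℂ] H)
  | 0 => B
  | k + 1 => bddCommutator A (ad A B k)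

/-- The iterated commutators of `B` with `A` are bounded operators up to the order `n`. -/
def HasBoundedAd (A : H →ₗ.[ℂ] H) (B : H →L[ℂ] H) (n : ℕ) : Prop :=
  ∀ k < n, ∃ T, IsCommutator A (ad A B k) T

theorem isCommutator_unique {A : H →ₗ.[ℂ] H} (hA : Dense (A.domain : Set H))
    {S T T' : H →L[ℂ] H} (h : IsCommutator A S T) (h' : IsCommutator A S T') : T = T' := by
  refine DFunLike.coe_injective (T.continuous.ext_on hA T'.continuous fun ψ hψ => ?_)
  exact hA.eq_of_inner_right ℂ fun φ hφ =>
    (h ⟨φ, hφ⟩ ⟨ψ, hψ⟩).trans (h' ⟨φ, hφ⟩ ⟨ψ, hψ⟩).symm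

end Commutators

/-! ### The class of functions -/

/-- The Fourier transform of the bounded function `f`, in the sense of distributions and normalized
by `f x = ∫ s, g s * exp (i s x)`, is given by the locally integrable function `g` away from the
origin. The test functions are supported away from the origin: at the origin the Fourier transform
of a bounded function may be singular (for example a point mass or a principal value). -/
def IsFourierDensity (f g : ℝ → ℂ) : Prop :=
  LocallyIntegrableOn g {0}ᶜ ∧
  ∀ φ : ℝ → ℂ, ContDiff ℝ ∞ φ → HasCompactSupport φ → (0 : ℝ) ∉ tsupport φ →
    ∫ x : ℝ, f x * ((1 / (2 * Real.pi) : ℂ) * ∫ s : ℝ, φ s * Complex.exp (-(Complex.I * s * x)))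
      = ∫ s : ℝ, g s * φ s

open Classical in
/-- The Fourier transform `f̂` of `f` away from the origin, as a function defined up to null sets
(and `0` by convention if it is not a function there). -/
def fhat (f : ℝ → ℂ) : ℝ → ℂ :=
  if h : ∃ g, IsFourierDensity f g then h.choose else 0

/-- The class `𝓑ₙ` of all smooth and bounded `f` with `∫ |f̂ s| |s| ^ k ds < ∞` for `1 ≤ k ≤ n`. -/
structure MemB (n : ℕ) (f : ℝ → ℂ) : Prop where
  smooth : ContDiff ℝ ∞ f
  bounded : ∃ C : ℝ, ∀ x, ‖f x‖ ≤ C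
  hasDensity : ∃ g, IsFourierDensity f g
  integrable : ∀ k : ℕ, 1 ≤ k → k ≤ n → Integrable (fun s : ℝ => ‖fhat f s‖ * |s| ^ k)

end

end CommutatorExpansion

open CommutatorExpansion

/-!
The proof expresses everything through the unitary group `U s = exp (i s A)`.

*Scalar part.* Let `g` be the density of the Fourier transform of `f` away from the origin. Testing
the definition of `g` against cut-offs `ψ (s / a) - ψ (a s)`, multiplied by `exp (i s y) - 1`, and
letting `a → ∞` gives `f y = f 0 + ∫ g s (exp (i s y) - 1) ds`, see
`eq_integral_of_isFourierDensity`: the part of `f` with frequencies of order `1 / a` varies less and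
less, since `f` is bounded, so that the singularity at the origin contributes only a constant.
Differentiation under the integral represents the derivatives of `f`.

*Functional calculus.* The map `f ↦ f(A)` is multiplicative and compatible with adjoints, and it
commutes with integration over a parameter (`funcCalc_integral`). For the scalar functions
`exp (i s x)` this yields that `U` is a strongly continuous unitary group that preserves the domain
of `A` and has the derivative `i U s A` there (`hasDerivAt_expI`). It also turns the scalar
representation of `f` into `f(A) = f 0 + ∫ g s (U s - 1) ds` on the domain of `A` and into
`f^(k)(A) = ∫ g s (i s)^k U s ds` for the derivatives.

*Commutators.* Consequently `[B, f(A)] = ∫ g s [B, U s] ds`. Duhamel's formula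
`[B, U s] = i ∫_0^s U (s - u) [B, A] U u du` (`inner_commutator_expI`, `commutator_expI_apply`)
gives the two integral representations. For the expansion, write
`[B, U s] = U s (U (-s) B U s - B)`. The derivative of `U (-s) B U s` is `i U (-s) [B, A] U s`, so
Taylor's formula of order `n` has the coefficients `i^k / k!` times the iterated commutators, and a
remainder of norm at most `|s|^n / n!` times the norm of the `n`-th commutator
(`norm_taylorRemainder_le`). Integration against `g` gives the first expansion, with the constant
`1 / n!`. The second expansion is the adjoint of the first one for the complex conjugate of `f`,
whose density is the complex conjugate of `g (-s)`.
-/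

namespace CommutatorExpansion

/-! ### Algebraic rules for the functional calculus -/

section FunctionalCalculusRules

variable {H : Type*} [NormedAddCommGroup H] [InnerProductSpace ℂ H] [CompleteSpace H]
  {A : H →ₗ.[ℂ] H}

theorem eq_of_comp_resolvent_eq (hA : IsSelfAdjoint A) {S T : H →L[ℂ] H}
    (h : S ∘L resolventAt A Complex.I = T ∘L resolventAt A Complex.I) : S = T :=
  DFunLike.coe_injective <| (denseRange_resolvent hA (Or.inl rfl)).equalizer S.continuous
    T.continuous (funext fun x => DFunLike.congr_fun h x)

theorem funcCalc_resolvent_apply (hA : IsSelfAdjoint A) {f : ℝ → ℂ} (hf : Continuous f) {C : ℝ}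
    (hC : ∀ x, ‖f x‖ ≤ C) (x : H) :
    funcCalc A f (resolventAt A Complex.I x)
      = cfc (resolventSymbol f) (resolventAt A Complex.I) x :=
  DFunLike.congr_fun (funcCalc_comp_resolvent hA hf hC) x

theorem norm_funcCalc_apply_le (hA : IsSelfAdjoint A) {f : ℝ → ℂ} (hf : Continuous f) {C : ℝ}
    (hC : ∀ x, ‖f x‖ ≤ C) (y : H) : ‖funcCalc A f y‖ ≤ C * ‖y‖ :=
  LinearMap.norm_extendOfNorm_apply_le (denseRange_resolvent hA (Or.inl rfl)) C
    (norm_cfc_resolventSymbol_le hA hf hC) y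

theorem commute_resolvent_cfc (A : H →ₗ.[ℂ] H) (k : ℂ → ℂ) :
    Commute (resolventAt A Complex.I) (cfc k (resolventAt A Complex.I)) := by
  by_cases h : IsStarNormal (resolventAt A Complex.I)
  · simpa [cfc_id] using cfc_commute_cfc (id : ℂ → ℂ) k (resolventAt A Complex.I)
  · rw [cfc_apply_of_not_predicate _ h]
    exact Commute.zero_right _

/-- `f(A)` commutes with the continuous functions of the resolvent. -/
theorem commute_funcCalc_cfc (hA : IsSelfAdjoint A) {f : ℝ → ℂ} (hf : Continuous f) {C : ℝ}
    (hC : ∀ x, ‖f x‖ ≤ C) (k : ℂ → ℂ) :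
    Commute (funcCalc A f) (cfc k (resolventAt A Complex.I)) := by
  refine eq_of_comp_resolvent_eq hA ?_
  change (funcCalc A f * cfc k _) * resolventAt A Complex.I
    = (cfc k _ * funcCalc A f) * resolventAt A Complex.I
  have h : funcCalc A f * resolventAt A Complex.I = _ := funcCalc_comp_resolvent hA hf hC
  rw [mul_assoc, ← (commute_resolvent_cfc A k).eq, ← mul_assoc, h, mul_assoc, h]
  exact (cfc_commute_cfc _ _ _).eq

theorem commute_funcCalc_resolvent (hA : IsSelfAdjoint A) {f : ℝ → ℂ} (hf : Continuous f) {C : ℝ}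
    (hC : ∀ x, ‖f x‖ ≤ C) : Commute (funcCalc A f) (resolventAt A Complex.I) := by
  have hN := isStarNormal_resolvent hA
  simpa [cfc_id] using commute_funcCalc_cfc hA hf hC (id : ℂ → ℂ)

theorem funcCalc_mul (hA : IsSelfAdjoint A) {f g : ℝ → ℂ} (hf : Continuous f) {C : ℝ}
    (hC : ∀ x, ‖f x‖ ≤ C) (hg : Continuous g) {D : ℝ} (hD : ∀ x, ‖g x‖ ≤ D) :
    funcCalc A (fun x => f x * g x) = funcCalc A f * funcCalc A g := by
  have hN := isStarNormal_resolvent hA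
  have hCD : ∀ x, ‖f x * g x‖ ≤ C * D := fun x => by
    rw [norm_mul]
    exact mul_le_mul (hC x) (hD x) (norm_nonneg _) ((norm_nonneg _).trans (hC x))
  have h1 : funcCalc A f * resolventAt A Complex.I = _ := funcCalc_comp_resolvent hA hf hC
  have h2 : funcCalc A g * resolventAt A Complex.I = _ := funcCalc_comp_resolvent hA hg hD
  have h3 : funcCalc A (fun x => f x * g x) * resolventAt A Complex.I = _ :=
    funcCalc_comp_resolvent hA (hf.mul hg) hCD
  have hk := continuous_resolventSymbol hf hC
  have hm := continuous_resolventSymbol hg hD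
  have hkm := continuous_resolventSymbol (hf.mul hg) hCD
  have h4 : cfc (resolventSymbol fun x => f x * g x) (resolventAt A Complex.I)
        * resolventAt A Complex.I
      = cfc (resolventSymbol f) (resolventAt A Complex.I)
        * cfc (resolventSymbol g) (resolventAt A Complex.I) := by
    nth_rw 2 [← cfc_id ℂ (resolventAt A Complex.I)]
    rw [← cfc_mul .., ← cfc_mul ..]
    congr 1
    ext z
    simp only [resolventSymbol, id]
    ring
  refine eq_of_comp_resolvent_eq hA (eq_of_comp_resolvent_eq hA ?_)
  change funcCalc A (fun x => f x * g x) * resolventAt A Complex.I * resolventAt A Complex.I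
    = funcCalc A f * funcCalc A g * resolventAt A Complex.I * resolventAt A Complex.I
  rw [h3, h4, mul_assoc (funcCalc A f), h2, mul_assoc, ← (commute_resolvent_cfc A _).eq,
    ← mul_assoc, h1]

theorem funcCalc_const (hA : IsSelfAdjoint A) (c : ℂ) :
    funcCalc A (fun _ => c) = c • (1 : H →L[ℂ] H) := by
  have hN := isStarNormal_resolvent hA
  refine (funcCalc_unique hA continuous_const (fun _ => le_refl ‖c‖) _ ?_).symm
  change c • 1 * resolventAt A Complex.I = _
  have : resolventSymbol (fun _ => c) = fun z => c * id z := by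
    ext z; simp [resolventSymbol, mul_comm]
  rw [this, cfc_const_mul .., cfc_id ℂ (resolventAt A Complex.I)]
  simp

theorem funcCalc_add (hA : IsSelfAdjoint A) {f g : ℝ → ℂ} (hf : Continuous f) {C : ℝ}
    (hC : ∀ x, ‖f x‖ ≤ C) (hg : Continuous g) {D : ℝ} (hD : ∀ x, ‖g x‖ ≤ D) :
    funcCalc A (fun x => f x + g x) = funcCalc A f + funcCalc A g := by
  have hN := isStarNormal_resolvent hA
  have hk := continuous_resolventSymbol hf hC
  have hm := continuous_resolventSymbol hg hD
  refine (funcCalc_unique hA (f := fun x => f x + g x) (hf.add hg) (C := C + D)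
    (fun x => (norm_add_le _ _).trans (add_le_add (hC x) (hD x))) _ ?_).symm
  have : resolventSymbol (fun x => f x + g x)
      = fun z => resolventSymbol f z + resolventSymbol g z := by
    ext z; simp [resolventSymbol, mul_add]
  rw [this, cfc_add .., ← funcCalc_comp_resolvent hA hf hC, ← funcCalc_comp_resolvent hA hg hD]
  rfl

theorem star_funcCalc (hA : IsSelfAdjoint A) {f : ℝ → ℂ} (hf : Continuous f) {C : ℝ}
    (hC : ∀ x, ‖f x‖ ≤ C) :
    star (funcCalc A f) = funcCalc A (fun x => star (f x)) := by
  have hN := isStarNormal_resolvent hA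
  have hf' : Continuous fun x => star (f x) := hf.star
  have hC' : ∀ x, ‖star (f x)‖ ≤ C := fun x => by rw [norm_star]; exact hC x
  have hk := continuous_resolventSymbol hf hC
  have hm := continuous_resolventSymbol hf' hC'
  have h1 : funcCalc A f * resolventAt A Complex.I = _ := funcCalc_comp_resolvent hA hf hC
  have h2 : funcCalc A (fun x => star (f x)) * resolventAt A Complex.I = _ :=
    funcCalc_comp_resolvent hA hf' hC'
  -- Both sides agree after multiplication by the resolvent on the right and by its adjoint on the
  -- left.
  have key : star (resolventAt A Complex.I) * (star (funcCalc A f) * resolventAt A Complex.I)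
      = star (resolventAt A Complex.I)
        * (funcCalc A (fun x => star (f x)) * resolventAt A Complex.I) := by
    rw [← mul_assoc, ← star_mul, h1, h2]
    nth_rw 2 3 [← cfc_id ℂ (resolventAt A Complex.I)]
    rw [← cfc_star, ← cfc_star, ← cfc_mul .., ← cfc_mul ..]
    congr 1
    ext z
    simp only [resolventSymbol, id, star_mul]
    ring
  refine eq_of_comp_resolvent_eq hA ?_
  ext x
  have hd := denseRange_resolvent hA (Or.inl rfl)
  refine hd.eq_of_inner_right ℂ fun v => ?_
  have := congrArg (fun S : H →L[ℂ] H => inner ℂ v (S x)) key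
  simpa [ContinuousLinearMap.star_eq_adjoint, ContinuousLinearMap.adjoint_inner_right] using this

theorem resolvent_sub_adjoint (hA : IsSelfAdjoint A) :
    resolventAt A Complex.I - star (resolventAt A Complex.I)
      = (-(2 * Complex.I)) • (resolventAt A Complex.I * star (resolventAt A Complex.I)) := by
  rw [adjoint_resolvent hA]
  ext x
  obtain ⟨h, e⟩ := resolvent_spec hA (Or.inr rfl) x
  have h1 := resolvent_addScalar hA (Or.inl rfl) ⟨_, h⟩
  have h2 : A ⟨resolventAt A (-Complex.I) x, h⟩ + Complex.I • resolventAt A (-Complex.I) x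
      = x + (2 * Complex.I) • resolventAt A (-Complex.I) x := by
    rw [eq_sub_of_add_eq e]
    module
  rw [addScalar_apply, h2, map_add, map_smul] at h1
  have h3 : resolventAt A Complex.I x + (2 * Complex.I) • resolventAt A Complex.I
      (resolventAt A (-Complex.I) x) = resolventAt A (-Complex.I) x := h1
  simp only [sub_apply, smul_apply, mul_apply_eq_comp]
  rw [eq_sub_of_add_eq h3]
  module

/-- The spectrum of `(A + i)⁻¹` lies on the circle of the points `1 / (x + i)`, `x` real, together
with `0`. -/
theorem inv_eq_of_mem_spectrum_resolvent (hA : IsSelfAdjoint A) {z : ℂ}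
    (hz : z ∈ spectrum ℂ (resolventAt A Complex.I)) (hz0 : z ≠ 0) :
    z⁻¹ = (z⁻¹).re + Complex.I := by
  have hN := isStarNormal_resolvent hA
  have h1 : cfc (fun w : ℂ => w - star w) (resolventAt A Complex.I)
      = cfc (fun w : ℂ => -(2 * Complex.I) * (w * star w)) (resolventAt A Complex.I) := by
    rw [cfc_sub .., cfc_const_mul .., cfc_mul .., cfc_star,
      cfc_id' ℂ (resolventAt A Complex.I), resolvent_sub_adjoint hA]
  have h2 := (cfc_eq_cfc_iff_eqOn (R := ℂ) (a := resolventAt A Complex.I) hN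
    (by fun_prop) (by fun_prop)).mp h1 hz
  simp only [Complex.star_def, Complex.mul_conj, Complex.sub_conj] at h2
  have h3 : z.im = -Complex.normSq z := by
    have := congrArg Complex.im h2
    simp at this
    linarith
  have h4 : Complex.normSq z ≠ 0 := by simpa using hz0
  apply Complex.ext
  · simp
  · simp [Complex.inv_im, h3, h4]

theorem ofReal_add_I_ne_zero (x : ℝ) : (x : ℂ) + Complex.I ≠ 0 := fun h => by
  simpa using congrArg Complex.im h

theorem norm_inv_ofReal_add_I_le (x : ℝ) : ‖((x : ℂ) + Complex.I)⁻¹‖ ≤ 1 := by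
  rw [norm_inv]
  refine inv_le_one_of_one_le₀ ?_
  simpa using Complex.abs_im_le_norm ((x : ℂ) + Complex.I)

theorem continuous_inv_ofReal_add_I : Continuous fun x : ℝ => ((x : ℂ) + Complex.I)⁻¹ :=
  Continuous.inv₀ (by fun_prop) ofReal_add_I_ne_zero

/-- The functional calculus reproduces the resolvent. -/
theorem funcCalc_inv_add_I (hA : IsSelfAdjoint A) :
    funcCalc A (fun x : ℝ => ((x : ℂ) + Complex.I)⁻¹) = resolventAt A Complex.I := by
  have hN := isStarNormal_resolvent hA
  refine (funcCalc_unique hA continuous_inv_ofReal_add_I norm_inv_ofReal_add_I_le _ ?_).symm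
  change resolventAt A Complex.I * resolventAt A Complex.I = _
  nth_rw 1 2 [← cfc_id ℂ (resolventAt A Complex.I)]
  rw [← cfc_mul ..]
  refine cfc_congr fun z hz => ?_
  rcases eq_or_ne z 0 with rfl | hz0
  · simp [resolventSymbol]
  · simp only [resolventSymbol, id]
    rw [← inv_eq_of_mem_spectrum_resolvent hA hz hz0, inv_inv]

theorem funcCalc_add_const_mul_inv (hA : IsSelfAdjoint A) {f : ℝ → ℂ} (hf : Continuous f) {C : ℝ}
    (hC : ∀ x, ‖f x‖ ≤ C) (c : ℂ) (y : H) :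
    funcCalc A (fun x => (f x + c) * ((x : ℂ) + Complex.I)⁻¹) y
      = funcCalc A f (resolventAt A Complex.I y) + c • resolventAt A Complex.I y := by
  rw [funcCalc_mul hA (f := fun x => f x + c) (hf.add continuous_const) (C := C + ‖c‖)
    (fun x => (norm_add_le _ _).trans (by gcongr; exact hC x))
    continuous_inv_ofReal_add_I norm_inv_ofReal_add_I_le,
    funcCalc_add hA (g := fun _ => c) hf hC continuous_const (fun _ => le_rfl), funcCalc_const hA,
    funcCalc_inv_add_I hA]
  rfl

end FunctionalCalculusRules

/-! ### Integrals of functions of the operator -/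

theorem continuous_integral_smul {H : Type*} [NormedAddCommGroup H] [NormedSpace ℂ H]
    {W : ℝ → H →L[ℂ] H} {b : ℝ → ℝ}
    (hW : ∀ s y, ‖W s y‖ ≤ b s * ‖y‖) {G : ℝ → ℂ} (hGb : Integrable fun s => ‖G s‖ * b s)
    (hint : ∀ y, Integrable fun s => G s • W s y) : Continuous fun y => ∫ s, G s • W s y := by
  have hadd : ∀ y z, ∫ s, G s • W s (y + z) = (∫ s, G s • W s y) + ∫ s, G s • W s z := fun y z => by
    rw [← integral_add (hint y) (hint z)]
    simp only [map_add, smul_add]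
  refine AddMonoidHomClass.continuous_of_bound (AddMonoidHom.mk' _ hadd)
    (∫ s, ‖G s‖ * b s) fun y => ?_
  change ‖∫ s, G s • W s y‖ ≤ _
  rw [← integral_mul_const]
  refine norm_integral_le_of_norm_le (hGb.mul_const _) (Eventually.of_forall fun s => ?_)
  rw [norm_smul, mul_assoc]
  gcongr
  exact hW s y

section ParameterIntegrals

variable {H : Type*} [NormedAddCommGroup H] [InnerProductSpace ℂ H] [CompleteSpace H]
  {A : H →ₗ.[ℂ] H}

theorem continuous_resolventSymbol_param {h : ℝ → ℝ → ℂ} (hh : Continuous (Function.uncurry h))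
    {b : ℝ → ℝ} (hb : Continuous b) (hbd : ∀ s x, ‖h s x‖ ≤ b s) :
    Continuous fun p : ℝ × ℂ => resolventSymbol (h p.1) p.2 := by
  rw [continuous_iff_continuousAt]
  rintro ⟨s, z⟩
  unfold resolventSymbol
  rcases eq_or_ne z 0 with rfl | hz
  · rw [ContinuousAt, zero_mul]
    refine squeeze_zero_norm (a := fun p : ℝ × ℂ => ‖p.2‖ * b p.1) (fun p => ?_) ?_
    · rw [norm_mul]; gcongr; exact hbd _ _
    · have : Continuous fun p : ℝ × ℂ => ‖p.2‖ * b p.1 := by fun_prop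
      simpa using this.tendsto (s, 0)
  · have h1 : ContinuousAt (fun p : ℝ × ℂ => (p.1, (p.2⁻¹).re)) (s, z) :=
      continuousAt_fst.prodMk (Complex.continuous_re.continuousAt.comp
        ((continuousAt_inv₀ hz).comp (f := Prod.snd) (x := (s, z)) continuousAt_snd))
    exact continuousAt_snd.mul (hh.continuousAt.comp h1)

theorem continuous_section {h : ℝ → ℝ → ℂ} (hh : Continuous (Function.uncurry h)) (s : ℝ) :
    Continuous (h s) := hh.comp (Continuous.prodMk_right s)

/-- The symbols of a family of functions form a continuous curve in the algebra of continuous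
functions on the spectrum of the resolvent. -/
theorem exists_symbol_curve (hA : IsSelfAdjoint A) {h : ℝ → ℝ → ℂ}
    (hh : Continuous (Function.uncurry h)) {b : ℝ → ℝ} (hb : Continuous b)
    (hbd : ∀ s x, ‖h s x‖ ≤ b s) :
    ∃ k : C(ℝ, C(spectrum ℂ (resolventAt A Complex.I), ℂ)),
      (∀ s z, k s z = resolventSymbol (h s) z) ∧
      ∀ s, cfc (resolventSymbol (h s)) (resolventAt A Complex.I)
        = cfcHom (isStarNormal_resolvent hA) (k s) := by
  have hk := continuous_resolventSymbol_param hh hb hbd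
  refine ⟨ContinuousMap.curry ⟨fun p => resolventSymbol (h p.1) p.2,
    hk.comp (f := fun p : ℝ × spectrum ℂ (resolventAt A Complex.I) => (p.1, (p.2 : ℂ)))
      (by fun_prop)⟩, fun s z => rfl, fun s => ?_⟩
  exact cfc_apply _ _ (isStarNormal_resolvent hA)
    (continuous_resolventSymbol (continuous_section hh s) (hbd s)).continuousOn

theorem continuous_funcCalc_param (hA : IsSelfAdjoint A) {h : ℝ → ℝ → ℂ}
    (hh : Continuous (Function.uncurry h)) {b : ℝ → ℝ} (hb : Continuous b)
    (hbd : ∀ s x, ‖h s x‖ ≤ b s) (y : H) : Continuous fun s => funcCalc A (h s) y := by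
  have hN := isStarNormal_resolvent hA
  obtain ⟨k, hkz, hks⟩ := exists_symbol_curve hA hh hb hbd
  have hR : ∀ x, Continuous fun s => funcCalc A (h s) (resolventAt A Complex.I x) := by
    intro x
    simp only [funcCalc_resolvent_apply hA (continuous_section hh _) (hbd _), hks]
    exact ((cfcHom_continuous hN).comp k.continuous).clm_apply continuous_const
  rw [continuous_iff_continuousAt]
  intro s₀
  -- The operators `h s (A)` are uniformly bounded near `s₀`, and strongly continuous on the range
  -- of the resolvent, which is dense.
  refine Metric.continuousAt_iff'.mpr fun ε hε => ?_
  have hb0 : 0 ≤ b s₀ := (norm_nonneg _).trans (hbd s₀ 0)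
  obtain ⟨x, hx⟩ := (denseRange_resolvent hA (Or.inl rfl)).exists_dist_lt y
    (show 0 < ε / (4 * (b s₀ + 1)) by positivity)
  set w := resolventAt A Complex.I x
  have h1 := Metric.continuousAt_iff'.mp ((hR x).continuousAt (x := s₀)) (ε / 2) (by positivity)
  have h2 : ∀ᶠ s in 𝓝 s₀, b s < b s₀ + 1 := hb.continuousAt.eventually_lt_const (by linarith)
  filter_upwards [h1, h2] with s hs1 hs2
  have h3 : ∀ t, b t < b s₀ + 1 → ‖funcCalc A (h t) (y - w)‖ ≤ ε / 4 := by
    intro t ht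
    refine (norm_funcCalc_apply_le hA (continuous_section hh t) (hbd t) _).trans ?_
    rw [← dist_eq_norm]
    calc b t * dist y w ≤ (b s₀ + 1) * (ε / (4 * (b s₀ + 1))) := by
          gcongr
      _ = ε / 4 := by field_simp
  have e : funcCalc A (h s) y - funcCalc A (h s₀) y
      = funcCalc A (h s) (y - w) + (funcCalc A (h s) w - funcCalc A (h s₀) w)
        - funcCalc A (h s₀) (y - w) := by
    simp only [map_sub]; abel
  rw [dist_eq_norm, e]
  rw [dist_eq_norm] at hs1
  have h4 := norm_sub_le (funcCalc A (h s) (y - w) + (funcCalc A (h s) w - funcCalc A (h s₀) w))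
    (funcCalc A (h s₀) (y - w))
  have h5 := norm_add_le (funcCalc A (h s) (y - w)) (funcCalc A (h s) w - funcCalc A (h s₀) w)
  linarith [h3 s hs2, h3 s₀ (by linarith)]

theorem integrable_smul_funcCalc (hA : IsSelfAdjoint A) {h : ℝ → ℝ → ℂ}
    (hh : Continuous (Function.uncurry h)) {b : ℝ → ℝ} (hb : Continuous b)
    (hbd : ∀ s x, ‖h s x‖ ≤ b s) {G : ℝ → ℂ} (hG : AEStronglyMeasurable G)
    (hGb : Integrable fun s => ‖G s‖ * b s) (y : H) :
    Integrable fun s => G s • funcCalc A (h s) y := by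
  refine (hGb.mul_const ‖y‖).mono'
    (hG.smul (continuous_funcCalc_param hA hh hb hbd y).aestronglyMeasurable)
    (Eventually.of_forall fun s => ?_)
  rw [norm_smul, mul_assoc]
  gcongr
  exact norm_funcCalc_apply_le hA (continuous_section hh s) (hbd s) y

/-- The functional calculus commutes with integration over a parameter. -/
theorem funcCalc_integral (hA : IsSelfAdjoint A) {h : ℝ → ℝ → ℂ}
    (hh : Continuous (Function.uncurry h)) {b : ℝ → ℝ} (hb : Continuous b)
    (hbd : ∀ s x, ‖h s x‖ ≤ b s) {G : ℝ → ℂ} (hG : AEStronglyMeasurable G)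
    (hGb : Integrable fun s => ‖G s‖ * b s) {F : ℝ → ℂ} (hF : ∀ x, F x = ∫ s, G s * h s x)
    (y : H) : funcCalc A F y = ∫ s, G s • funcCalc A (h s) y := by
  have hN := isStarNormal_resolvent hA
  have hb0 : ∀ s, 0 ≤ b s := fun s => (norm_nonneg _).trans (hbd s 0)
  have hint := integrable_smul_funcCalc hA hh hb hbd hG hGb
  have hFc : Continuous F := by
    rw [funext hF]
    refine continuous_of_dominated (fun x => hG.mul (hh.comp
      (Continuous.prodMk_left x)).aestronglyMeasurable) (fun x => Eventually.of_forall fun s => ?_)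
      hGb (Eventually.of_forall fun s => continuous_const.mul (continuous_section hh s))
    rw [norm_mul]
    gcongr
    exact hbd s x
  have hFb : ∀ x, ‖F x‖ ≤ ∫ s, ‖G s‖ * b s := fun x => by
    rw [hF]
    refine norm_integral_le_of_norm_le hGb (Eventually.of_forall fun s => ?_)
    rw [norm_mul]
    gcongr
    exact hbd s x
  obtain ⟨k, hkz, hks⟩ := exists_symbol_curve hA hh hb hbd
  obtain ⟨M, hM⟩ := (spectrum.isCompact (𝕜 := ℂ) (resolventAt A Complex.I)).isBounded.exists_norm_le
  have hki : Integrable fun s => G s • k s := by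
    refine (hGb.mul_const (max M 0)).mono' (hG.smul k.continuous.aestronglyMeasurable)
      (Eventually.of_forall fun s => ?_)
    rw [norm_smul, mul_assoc]
    gcongr
    refine (ContinuousMap.norm_le _ (mul_nonneg (hb0 s) (le_max_right _ _))).mpr fun z => ?_
    rw [hkz, resolventSymbol, norm_mul, mul_comm]
    exact mul_le_mul (hbd _ _) ((hM _ z.2).trans (le_max_left _ _)) (norm_nonneg _) (hb0 s)
  have hFk : cfc (resolventSymbol F) (resolventAt A Complex.I) = cfcHom hN (∫ s, G s • k s) := by
    rw [cfc_apply _ _ hN (continuous_resolventSymbol hFc hFb).continuousOn]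
    congr 1
    ext z
    rw [ContinuousMap.integral_apply hki]
    change resolventSymbol F z = ∫ s, G s * k s z
    simp only [hkz, resolventSymbol, hF]
    rw [← integral_const_mul]
    congr 1
    ext s
    ring
  -- Both sides are continuous in `y`, and they agree on the range of the resolvent.
  have hcont : Continuous fun y => ∫ s, G s • funcCalc A (h s) y :=
    continuous_integral_smul
      (fun s y => norm_funcCalc_apply_le hA (continuous_section hh s) (hbd s) y) hGb hint
  refine congrFun ((denseRange_resolvent hA (Or.inl rfl)).equalizer (funcCalc A F).continuous hcont
    (funext fun x => ?_)) y
  simp only [Function.comp_apply, funcCalc_resolvent_apply hA hFc hFb,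
    funcCalc_resolvent_apply hA (continuous_section hh _) (hbd _), hks, hFk]
  have h1 := ContinuousLinearMap.integral_comp_comm (cfcL (R := ℂ) hN) hki
  change (cfcL (R := ℂ) hN (∫ s, G s • k s)) x = _
  rw [← h1, ContinuousLinearMap.integral_apply ((cfcL (R := ℂ) hN).integrable_comp hki)]
  simp only [map_smul, smul_apply]
  rfl

end ParameterIntegrals

/-! ### The unitary group -/

section UnitaryGroup

variable {H : Type*} [NormedAddCommGroup H] [InnerProductSpace ℂ H] [CompleteSpace H]
  {A : H →ₗ.[ℂ] H}

theorem norm_exp_I_mul_le (s x : ℝ) : ‖Complex.exp (Complex.I * s * x)‖ ≤ 1 := by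
  rw [mul_assoc, mul_comm, ← Complex.ofReal_mul, Complex.norm_exp_ofReal_mul_I]

theorem continuous_exp_I_mul (s : ℝ) :
    Continuous fun x : ℝ => Complex.exp (Complex.I * s * x) := by fun_prop

theorem expI_add (hA : IsSelfAdjoint A) (s t : ℝ) : expI A (s + t) = expI A s * expI A t := by
  unfold expI
  rw [← funcCalc_mul hA (continuous_exp_I_mul s) (norm_exp_I_mul_le s)
    (continuous_exp_I_mul t) (norm_exp_I_mul_le t)]
  congr 1
  ext x
  rw [← Complex.exp_add]
  congr 1
  push_cast
  ring

theorem expI_zero (hA : IsSelfAdjoint A) : expI A 0 = 1 := by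
  have h := funcCalc_const hA 1
  rw [one_smul] at h
  rw [← h]
  simp [expI]

theorem expI_add_apply (hA : IsSelfAdjoint A) (s t : ℝ) (y : H) :
    expI A (s + t) y = expI A s (expI A t y) := by rw [expI_add hA]; rfl

theorem expI_neg_apply_expI (hA : IsSelfAdjoint A) (s : ℝ) (y : H) :
    expI A (-s) (expI A s y) = y := by
  rw [← expI_add_apply hA, neg_add_cancel, expI_zero hA]; rfl

theorem expI_apply_expI_neg (hA : IsSelfAdjoint A) (s : ℝ) (y : H) :
    expI A s (expI A (-s) y) = y := by
  rw [← expI_add_apply hA, add_neg_cancel, expI_zero hA]; rfl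

theorem star_expI (hA : IsSelfAdjoint A) (s : ℝ) : star (expI A s) = expI A (-s) := by
  unfold expI
  rw [star_funcCalc hA (continuous_exp_I_mul s) (norm_exp_I_mul_le s)]
  congr 1
  ext x
  rw [Complex.star_def, ← Complex.exp_conj]
  congr 1
  simp

theorem inner_expI_neg_left (hA : IsSelfAdjoint A) (s : ℝ) (x y : H) :
    inner ℂ (expI A (-s) x) y = inner ℂ x (expI A s y) := by
  rw [← star_expI hA, ContinuousLinearMap.star_eq_adjoint, ContinuousLinearMap.adjoint_inner_left]

theorem norm_expI_apply_le (hA : IsSelfAdjoint A) (s : ℝ) (y : H) : ‖expI A s y‖ ≤ ‖y‖ := by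
  exact (norm_funcCalc_apply_le hA (continuous_exp_I_mul s) (norm_exp_I_mul_le s) y).trans_eq
    (one_mul _)

theorem continuous_expI_apply (hA : IsSelfAdjoint A) (y : H) : Continuous fun s => expI A s y := by
  refine continuous_funcCalc_param hA (h := fun s x => Complex.exp (Complex.I * s * x)) ?_
    (continuous_const (y := (1 : ℝ))) norm_exp_I_mul_le y
  unfold Function.uncurry
  fun_prop

theorem continuous_expI_comp (hA : IsSelfAdjoint A) {X : Type*} [TopologicalSpace X] {v : X → ℝ}
    (hv : Continuous v) {w : X → H} (hw : Continuous w) :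
    Continuous fun x => expI A (v x) (w x) := by
  rw [continuous_iff_continuousAt]
  intro x₀
  have h1 : Tendsto (fun x => expI A (v x) (w x₀)) (𝓝 x₀) (𝓝 (expI A (v x₀) (w x₀))) :=
    (((continuous_expI_apply hA (w x₀)).comp hv).tendsto x₀)
  have h2 : Tendsto (fun x => expI A (v x) (w x - w x₀)) (𝓝 x₀) (𝓝 0) := by
    refine squeeze_zero_norm (fun x => norm_expI_apply_le hA _ _) ?_
    have : Continuous fun x => ‖w x - w x₀‖ := by fun_prop
    simpa using this.tendsto x₀
  simpa [ContinuousAt] using h2.add h1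

/-- The unitary group preserves the domain of its generator and commutes with it there. -/
theorem expI_domain (hA : IsSelfAdjoint A) (s : ℝ) (ψ : A.domain) :
    ∃ h : expI A s ψ ∈ A.domain, A ⟨expI A s ψ, h⟩ = expI A s (A ψ) := by
  have h1 := resolvent_addScalar hA (Or.inl rfl) ψ
  have h2 : expI A s ψ = resolventAt A Complex.I (expI A s (addScalar A Complex.I ψ)) := by
    conv_lhs => rw [← h1]
    exact DFunLike.congr_fun (commute_funcCalc_resolvent hA (continuous_exp_I_mul s)
      (norm_exp_I_mul_le s)).eq _
  obtain ⟨h, e⟩ := resolvent_spec hA (Or.inl rfl) (expI A s (addScalar A Complex.I ψ))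
  refine ⟨h2 ▸ h, ?_⟩
  simp only [← h2] at e
  refine add_right_cancel (e.trans ?_)
  rw [addScalar_apply, map_add, map_smul]

theorem expI_mem_domain (hA : IsSelfAdjoint A) (s : ℝ) (ψ : A.domain) :
    expI A s ψ ∈ A.domain := (expI_domain hA s ψ).1

theorem apply_expI (hA : IsSelfAdjoint A) (s : ℝ) (ψ : A.domain) (h : expI A s ψ ∈ A.domain) :
    A ⟨expI A s ψ, h⟩ = expI A s (A ψ) := (expI_domain hA s ψ).2

/-- The scalar form of Duhamel's formula for the unitary group, multiplied by the resolvent function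
to make the integrand bounded in `x`. -/
theorem integral_zero_one_exp (s x : ℝ) :
    ∫ u in (0 : ℝ)..1, (Complex.I * s) * (x * ((x : ℂ) + Complex.I)⁻¹)
        * Complex.exp (Complex.I * ((s * u : ℝ) : ℂ) * x)
      = (Complex.exp (Complex.I * s * x) - 1) * ((x : ℂ) + Complex.I)⁻¹ := by
  have hd : ∀ u : ℝ, HasDerivAt (fun u : ℝ => Complex.exp (Complex.I * ((s * u : ℝ) : ℂ) * x)
      * ((x : ℂ) + Complex.I)⁻¹) ((Complex.I * s) * (x * ((x : ℂ) + Complex.I)⁻¹)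
        * Complex.exp (Complex.I * ((s * u : ℝ) : ℂ) * x)) u := by
    intro u
    have h0 : HasDerivAt (fun u : ℝ => ((s * u : ℝ) : ℂ)) s u := by
      simpa using ((hasDerivAt_id u).const_mul s).ofReal_comp
    have h1 := (((h0.const_mul Complex.I).mul_const (x : ℂ)).cexp).mul_const
      ((x : ℂ) + Complex.I)⁻¹
    refine h1.congr_deriv ?_
    ring
  rw [intervalIntegral.integral_eq_sub_of_hasDerivAt (fun u _ => hd u)
    (Continuous.intervalIntegrable (by fun_prop) _ _)]
  simp [sub_mul]

/-- Duhamel's formula for the unitary group. -/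
theorem expI_sub_eq_integral (hA : IsSelfAdjoint A) (s : ℝ) (ψ : A.domain) :
    expI A s ψ - ψ = Complex.I • ∫ u in (0 : ℝ)..s, expI A u (A ψ) := by
  set y := addScalar A Complex.I ψ with hy
  have hψ : resolventAt A Complex.I y = ψ := resolvent_addScalar hA (Or.inl rfl) ψ
  let q : ℝ → ℂ := fun x => x * ((x : ℂ) + Complex.I)⁻¹
  have hqc : Continuous q := Complex.continuous_ofReal.mul continuous_inv_ofReal_add_I
  have hqe : ∀ x : ℝ, q x = 1 + (-Complex.I) * ((x : ℂ) + Complex.I)⁻¹ := fun x => by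
    have := ofReal_add_I_ne_zero x
    simp only [q]
    field_simp
    ring
  have hI : ∀ x : ℝ, ‖-Complex.I * ((x : ℂ) + Complex.I)⁻¹‖ ≤ 1 := fun x => by
    simpa using norm_inv_ofReal_add_I_le x
  have hqb : ∀ x, ‖q x‖ ≤ 2 := fun x => by
    rw [hqe]
    refine (norm_add_le _ _).trans ?_
    have := hI x
    rw [norm_one]
    linarith
  -- The bounded operator `A (A + i)⁻¹`.
  have hq : funcCalc A q y = A ψ := by
    rw [funext hqe, funcCalc_add hA (f := fun _ => 1) (g := fun x => -Complex.I * (x + Complex.I)⁻¹)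
      continuous_const (fun _ => norm_one.le)
      (continuous_const.mul continuous_inv_ofReal_add_I) hI,
      funcCalc_mul hA (f := fun _ => -Complex.I) continuous_const (fun _ => le_rfl)
        continuous_inv_ofReal_add_I norm_inv_ofReal_add_I_le, funcCalc_const hA, funcCalc_const hA,
        funcCalc_inv_add_I hA]
    simp only [add_apply, smul_apply, mul_apply_eq_comp, one_smul,
      one_apply_eq_self, hψ]
    rw [hy, addScalar_apply]
    module
  let h : ℝ → ℝ → ℂ := fun u x =>
    (Complex.I * s) * q x * Complex.exp (Complex.I * ((s * u : ℝ) : ℂ) * x)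
  have hh : Continuous (Function.uncurry h) := by
    have h2 : Continuous fun p : ℝ × ℝ => q p.2 := hqc.comp continuous_snd
    unfold Function.uncurry
    simp only [h]
    fun_prop
  have hbd : ∀ u x, ‖h u x‖ ≤ |s| * 2 := fun u x => by
    have h1 := norm_exp_I_mul_le (s * u) x
    simp only [h, norm_mul, Complex.norm_I, one_mul, Complex.norm_real, Real.norm_eq_abs]
    exact mul_le_of_le_one_right (by positivity) h1 |>.trans (by gcongr; exact hqb x)
  have hfh : ∀ u, funcCalc A (h u) y = (Complex.I * s) • expI A (s * u) (A ψ) := by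
    intro u
    have e : h u = fun x : ℝ =>
        (Complex.I * s) * (Complex.exp (Complex.I * ((s * u : ℝ) : ℂ) * x) * q x) := by
      ext x; simp only [h]; ring
    rw [e, funcCalc_mul hA (f := fun _ => Complex.I * s)
      (g := fun x : ℝ => Complex.exp (Complex.I * ((s * u : ℝ) : ℂ) * x) * q x)
      continuous_const (fun _ => le_rfl) ((continuous_exp_I_mul _).mul hqc) (D := 1 * 2)
      (fun x => ?_), funcCalc_const hA,
      funcCalc_mul hA (continuous_exp_I_mul _) (norm_exp_I_mul_le _) hqc hqb]
    · simp only [mul_apply_eq_comp, smul_apply, one_apply_eq_self, hq]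
      rfl
    · rw [norm_mul]
      exact mul_le_mul (norm_exp_I_mul_le _ _) (hqb x) (norm_nonneg _) zero_le_one
  let F : ℝ → ℂ := fun x => (Complex.exp (Complex.I * s * x) + (-1)) * ((x : ℂ) + Complex.I)⁻¹
  have hF : funcCalc A F y = expI A s ψ - ψ := by
    rw [funcCalc_add_const_mul_inv hA (continuous_exp_I_mul s) (norm_exp_I_mul_le s), hψ,
      neg_one_smul, ← sub_eq_add_neg]
    rfl
  -- The integral over `[0, s]` is rescaled to `[0, 1]`, which covers both signs of `s` at once.
  have key := funcCalc_integral hA hh continuous_const hbd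
    (G := (Set.Ioc (0 : ℝ) 1).indicator fun _ => 1)
    (aestronglyMeasurable_const.indicator measurableSet_Ioc) (F := F) ?_ ?_ y
  · rw [hF] at key
    rw [key]
    have e : ∀ u : ℝ, (Set.Ioc (0 : ℝ) 1).indicator (fun _ => (1 : ℂ)) u • funcCalc A (h u) y
        = (Set.Ioc (0 : ℝ) 1).indicator (fun u => (Complex.I * s) • expI A (s * u) (A ψ)) u := by
      intro u
      by_cases hu : u ∈ Set.Ioc (0 : ℝ) 1 <;> simp [hu, hfh]
    simp only [e]
    rw [integral_indicator measurableSet_Ioc, ← intervalIntegral.integral_of_le zero_le_one,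
      intervalIntegral.integral_smul, mul_smul]
    congr 1
    have := intervalIntegral.smul_integral_comp_mul_left (a := 0) (b := 1)
      (fun u => expI A u (A ψ)) s
    rw [mul_zero, mul_one] at this
    rw [← this]
    exact Complex.coe_smul _ _
  · have e : ∀ s_1 : ℝ, ‖(Set.Ioc (0 : ℝ) 1).indicator (fun _ => (1 : ℂ)) s_1‖ * (|s| * 2)
        = (Set.Ioc (0 : ℝ) 1).indicator (fun _ => |s| * 2) s_1 := fun t => by
      by_cases hu : t ∈ Set.Ioc (0 : ℝ) 1 <;> simp [hu]
    rw [funext e]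
    exact (integrable_indicator_iff measurableSet_Ioc).mpr continuous_const.integrableOn_Ioc
  · intro x
    have e : ∀ u : ℝ, (Set.Ioc (0 : ℝ) 1).indicator (fun _ => (1 : ℂ)) u * h u x
        = (Set.Ioc (0 : ℝ) 1).indicator (fun u => h u x) u := fun u => by
      by_cases hu : u ∈ Set.Ioc (0 : ℝ) 1 <;> simp [hu]
    simp only [e]
    rw [integral_indicator measurableSet_Ioc, ← intervalIntegral.integral_of_le zero_le_one]
    exact (integral_zero_one_exp s x).symm

theorem hasDerivAt_expI (hA : IsSelfAdjoint A) (ψ : A.domain) (s : ℝ) :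
    HasDerivAt (fun s => expI A s ψ) (Complex.I • expI A s (A ψ)) s := by
  have h1 := (continuous_expI_apply hA (A ψ)).integral_hasStrictDerivAt 0 s
  have h2 := (h1.hasDerivAt.const_smul Complex.I).const_add (ψ : H)
  refine h2.congr_of_eventuallyEq (Eventually.of_forall fun t => ?_)
  change _ = (ψ : H) + Complex.I • ∫ u in (0 : ℝ)..t, expI A u (A ψ)
  rw [← expI_sub_eq_integral hA]
  abel

end UnitaryGroup

/-! ### Commutators with the unitary group -/

section CommutatorForms

variable {H : Type*} [NormedAddCommGroup H] [InnerProductSpace ℂ H] {A : H →ₗ.[ℂ] H}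

theorem isCommutator_ad {B : H →L[ℂ] H} {n : ℕ} (h : HasBoundedAd A B n) {k : ℕ} (hk : k < n) :
    IsCommutator A (ad A B k) (ad A B (k + 1)) := by
  have := h k hk
  rw [ad, bddCommutator, dif_pos this]
  exact this.choose_spec

theorem IsCommutator.smul {S T : H →L[ℂ] H} (h : IsCommutator A S T) (c : ℂ) :
    IsCommutator A (c • S) (c • T) := by
  intro φ ψ
  have h1 := h φ ψ
  rw [commForm] at h1
  rw [commForm, smul_apply, smul_apply, smul_apply, inner_smul_right, inner_smul_right,
    inner_smul_right, h1]
  ring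

end CommutatorForms

section GroupCommutators

variable {H : Type*} [NormedAddCommGroup H] [InnerProductSpace ℂ H] [CompleteSpace H]
  {A : H →ₗ.[ℂ] H}

theorem commForm_expI (hA : IsSelfAdjoint A) (S : H →L[ℂ] H) (φ ψ : A.domain) (t u : ℝ)
    (ht : expI A t φ ∈ A.domain) (hu : expI A u ψ ∈ A.domain) :
    commForm A S ⟨expI A t φ, ht⟩ ⟨expI A u ψ, hu⟩
      = inner ℂ (expI A t φ) (S (expI A u (A ψ))) - inner ℂ (expI A t (A φ)) (S (expI A u ψ)) := by
  rw [commForm, apply_expI hA, apply_expI hA]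

theorem continuous_commForm_expI (hA : IsSelfAdjoint A) (S : H →L[ℂ] H)
    (hdom : ∀ (u : ℝ) (ψ : A.domain), expI A u ψ ∈ A.domain) (φ ψ : A.domain) (s : ℝ) :
    Continuous fun u : ℝ => commForm A S
      ⟨expI A (-(s - u)) φ, hdom _ φ⟩ ⟨expI A u ψ, hdom u ψ⟩ := by
  simp only [commForm_expI hA]
  have h1 : ∀ x : H, Continuous fun u : ℝ => expI A (-(s - u)) x := fun x =>
    (continuous_expI_apply hA x).comp (by fun_prop)
  exact ((h1 _).inner (S.continuous.comp (continuous_expI_apply hA _))).sub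
    ((h1 _).inner (S.continuous.comp (continuous_expI_apply hA _)))

/-- Duhamel's formula for the commutator with the unitary group, in the sense of forms. -/
theorem inner_commutator_expI (hA : IsSelfAdjoint A) (S : H →L[ℂ] H)
    (hdom : ∀ (u : ℝ) (ψ : A.domain), expI A u ψ ∈ A.domain) (φ ψ : A.domain) (s : ℝ) :
    inner ℂ (φ : H) (S (expI A s ψ) - expI A s (S ψ)) = Complex.I * ∫ u in (0 : ℝ)..s,
      commForm A S ⟨expI A (-(s - u)) φ, hdom _ φ⟩ ⟨expI A u ψ, hdom u ψ⟩ := by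
  have hd : ∀ u : ℝ, HasDerivAt
      (fun u : ℝ => inner ℂ (expI A (-(s - u)) φ) (S (expI A u ψ)))
      (Complex.I * commForm A S ⟨expI A (-(s - u)) φ, hdom _ φ⟩ ⟨expI A u ψ, hdom u ψ⟩) u := by
    intro u
    have h0 : HasDerivAt (fun u : ℝ => -(s - u)) 1 u := by
      simpa using ((hasDerivAt_id u).const_sub s).fun_neg
    have h1 := (hasDerivAt_expI hA φ (-(s - u))).scomp u h0
    have h2 := (S.restrictScalars ℝ).hasFDerivAt.comp_hasDerivAt u (hasDerivAt_expI hA ψ u)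
    refine (h1.inner ℂ h2).congr_deriv ?_
    simp only [ContinuousLinearMap.coe_restrictScalars', Function.comp_apply, one_smul, map_smul,
      inner_smul_left, inner_smul_right, Complex.conj_I, commForm_expI hA]
    ring
  rw [← intervalIntegral.integral_const_mul, intervalIntegral.integral_eq_sub_of_hasDerivAt
    (fun u _ => hd u) ((continuous_const.mul
      (continuous_commForm_expI hA S hdom φ ψ s)).intervalIntegrable _ _)]
  rw [sub_self, neg_zero, sub_zero, inner_expI_neg_left hA, expI_zero hA, inner_sub_right]
  rfl

theorem continuous_expI_comp_expI (hA : IsSelfAdjoint A) (T : H →L[ℂ] H) (ψ : H) (s : ℝ) :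
    Continuous fun u : ℝ => expI A (s - u) (T (expI A u ψ)) :=
  continuous_expI_comp hA (by fun_prop) (T.continuous.comp (continuous_expI_apply hA ψ))

/-- Duhamel's formula for the commutator with the unitary group, as an operator identity. -/
theorem commutator_expI_apply (hA : IsSelfAdjoint A) {S T : H →L[ℂ] H} (hT : IsCommutator A S T)
    (s : ℝ) (ψ : H) : S (expI A s ψ) - expI A s (S ψ)
      = Complex.I • ∫ u in (0 : ℝ)..s, expI A (s - u) (T (expI A u ψ)) := by
  have hcont : Continuous fun ψ : H =>
      Complex.I • ∫ u in (0 : ℝ)..s, expI A (s - u) (T (expI A u ψ)) := by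
    refine Continuous.const_smul
      (intervalIntegral.continuous_parametric_intervalIntegral_of_continuous' ?_ 0 s) _
    exact continuous_expI_comp hA (by fun_prop)
      (T.continuous.comp (continuous_expI_comp hA continuous_snd continuous_fst))
  have hcont' : Continuous fun ψ : H => S (expI A s ψ) - expI A s (S ψ) := by fun_prop
  refine congrFun (Continuous.ext_on hA.dense_domain hcont' hcont fun ψ hψ => ?_) ψ
  refine hA.dense_domain.eq_of_inner_right ℂ fun φ hφ => ?_
  rw [inner_commutator_expI hA S (expI_mem_domain hA) ⟨φ, hφ⟩ ⟨ψ, hψ⟩, inner_smul_right]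
  congr 1
  have h1 := ContinuousLinearMap.intervalIntegral_comp_comm (innerSL ℂ φ)
    ((continuous_expI_comp_expI hA T ψ s).intervalIntegrable (μ := volume) 0 s)
  simp only [innerSL_apply_apply] at h1
  rw [← h1]
  congr 1
  ext u
  rw [← hT]
  exact inner_expI_neg_left hA _ _ _

theorem norm_commutator_expI_apply_le (hA : IsSelfAdjoint A) {S T : H →L[ℂ] H}
    (hT : IsCommutator A S T) (s : ℝ) (ψ : H) :
    ‖S (expI A s ψ) - expI A s (S ψ)‖ ≤ |s| * (‖T‖ * ‖ψ‖) := by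
  rw [commutator_expI_apply hA hT, norm_smul, Complex.norm_I, one_mul, mul_comm]
  have h := intervalIntegral.norm_integral_le_of_norm_le_const (a := 0) (b := s)
    (f := fun u => expI A (s - u) (T (expI A u ψ))) (C := ‖T‖ * ‖ψ‖) fun u _ => by
      refine (norm_expI_apply_le hA _ _).trans ((T.le_opNorm _).trans ?_)
      gcongr
      exact norm_expI_apply_le hA _ _
  simpa using h

/-- The remainder of the Taylor expansion of order `n` in `s` of `exp (-i s A) S₀ exp (i s A)`,
where `S₁, S₂, …` stand for the iterated commutators of `S₀` with `A`. -/
noncomputable def taylorRemainder (A : H →ₗ.[ℂ] H) (S : ℕ → H →L[ℂ] H) (n : ℕ) (s : ℝ) (ψ : H) :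
    H :=
  expI A (-s) (S 0 (expI A s ψ))
    - ∑ k ∈ Finset.range n, ((Complex.I * s) ^ k / (k.factorial : ℂ)) • S k ψ

theorem integral_I_mul_pow (k : ℕ) (s : ℝ) :
    Complex.I * ∫ u in (0 : ℝ)..s, (Complex.I * u) ^ k / (k.factorial : ℂ)
      = (Complex.I * s) ^ (k + 1) / ((k + 1).factorial : ℂ) := by
  have hd : ∀ u : ℝ, HasDerivAt (fun u : ℝ => (Complex.I * u) ^ (k + 1) / ((k + 1).factorial : ℂ))
      (Complex.I * ((Complex.I * u) ^ k / (k.factorial : ℂ))) u := by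
    intro u
    have h1 := (((hasDerivAt_id u).ofReal_comp.const_mul Complex.I).pow (k + 1)).div_const
      ((k + 1).factorial : ℂ)
    refine h1.congr_deriv ?_
    have h2 : (k.factorial : ℂ) ≠ 0 := by exact_mod_cast k.factorial_ne_zero
    have h3 : (k : ℂ) + 1 ≠ 0 := by exact_mod_cast k.succ_ne_zero
    rw [Nat.factorial_succ]
    push_cast
    field_simp
    simp
  rw [← intervalIntegral.integral_const_mul, intervalIntegral.integral_eq_sub_of_hasDerivAt
    (fun u _ => hd u) (Continuous.intervalIntegrable (by fun_prop) _ _)]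
  simp

theorem continuous_taylorRemainder (hA : IsSelfAdjoint A) (S : ℕ → H →L[ℂ] H) (n : ℕ) (ψ : H) :
    Continuous fun s => taylorRemainder A S n s ψ := by
  have h1 : Continuous fun s => expI A (-s) (S 0 (expI A s ψ)) :=
    continuous_expI_comp hA (by fun_prop) ((S 0).continuous.comp (continuous_expI_apply hA ψ))
  unfold taylorRemainder
  fun_prop

/-- Differentiating `exp (-i s A) S₀ exp (i s A)` replaces `S₀` by `i S₁`, which lowers the order of
the Taylor remainder by one. -/
theorem taylorRemainder_succ (hA : IsSelfAdjoint A) (S : ℕ → H →L[ℂ] H)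
    (hS : IsCommutator A (S 0) (S 1)) (n : ℕ) (s : ℝ) (ψ : H) :
    taylorRemainder A S (n + 1) s ψ
      = Complex.I • ∫ u in (0 : ℝ)..s, taylorRemainder A (fun k => S (k + 1)) n u ψ := by
  have h1 : expI A (-s) (S 0 (expI A s ψ)) - S 0 ψ
      = Complex.I • ∫ u in (0 : ℝ)..s, expI A (-u) (S 1 (expI A u ψ)) := by
    have h2 := congrArg (expI A (-s)) (commutator_expI_apply hA hS s ψ)
    rw [map_sub, map_smul, expI_neg_apply_expI hA] at h2
    rw [h2, ← ContinuousLinearMap.intervalIntegral_comp_comm (expI A (-s))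
      ((continuous_expI_comp_expI hA (S 1) ψ s).intervalIntegrable (μ := volume) 0 s)]
    congr 2
    ext u
    rw [← expI_add_apply hA]
    congr 2
    ring
  have hc1 : Continuous fun u => expI A (-u) (S 1 (expI A u ψ)) :=
    continuous_expI_comp hA (by fun_prop) ((S 1).continuous.comp (continuous_expI_apply hA ψ))
  have hc2 : ∀ k : ℕ, Continuous fun u : ℝ =>
      ((Complex.I * u) ^ k / (k.factorial : ℂ)) • S (k + 1) ψ := fun k => by fun_prop
  unfold taylorRemainder
  rw [intervalIntegral.integral_sub (hc1.intervalIntegrable _ _)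
    ((continuous_finsetSum _ fun k _ => hc2 k).intervalIntegrable _ _), smul_sub, ← h1,
    intervalIntegral.integral_finsetSum fun k _ => (hc2 k).intervalIntegrable _ _,
    Finset.smul_sum, Finset.sum_range_succ', sub_sub, add_comm]
  congr 2
  · simp
  · refine Finset.sum_congr rfl fun k _ => ?_
    rw [intervalIntegral.integral_smul_const, smul_smul, integral_I_mul_pow]

theorem norm_taylorRemainder_le (hA : IsSelfAdjoint A) (n : ℕ) :
    ∀ (S : ℕ → H →L[ℂ] H), (∀ k < n, IsCommutator A (S k) (S (k + 1))) → ∀ (s : ℝ) (ψ : H),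
      ‖taylorRemainder A S n s ψ‖ ≤ |s| ^ n / n.factorial * (‖S n‖ * ‖ψ‖) := by
  induction n with
  | zero =>
    intro S _ s ψ
    simp only [taylorRemainder, Finset.range_zero, Finset.sum_empty, sub_zero, pow_zero,
      Nat.factorial_zero, Nat.cast_one, div_one, one_mul]
    refine (norm_expI_apply_le hA _ _).trans (((S 0).le_opNorm _).trans ?_)
    gcongr
    exact norm_expI_apply_le hA _ _
  | succ n ih =>
    intro S hS s ψ
    have ih' := ih (fun k => S (k + 1)) fun k hk => hS (k + 1) (by omega)
    rw [taylorRemainder_succ hA S (hS 0 (by omega)), norm_smul, Complex.norm_I, one_mul]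
    refine intervalIntegral.norm_integral_le_integral_norm_uIoc.trans ?_
    have h1 : ∫ u in Set.uIoc 0 s, ‖taylorRemainder A (fun k => S (k + 1)) n u ψ‖
        ≤ ∫ u in Set.uIoc 0 s, |u - 0| ^ n * (1 / n.factorial * (‖S (n + 1)‖ * ‖ψ‖)) := by
      refine integral_mono ?_ ?_ fun u => ?_
      · exact (continuous_taylorRemainder hA _ n ψ).norm.integrableOn_uIoc
      · exact Continuous.integrableOn_uIoc (by fun_prop)
      · refine (ih' u ψ).trans (le_of_eq ?_)
        rw [sub_zero]
        ring
    refine h1.trans (le_of_eq ?_)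
    rw [integral_mul_const, integral_pow_abs_sub_uIoc, sub_zero, Nat.factorial_succ]
    push_cast
    field_simp

/-- The adjoint of a commutator with a self-adjoint operator. -/
theorem IsCommutator.neg_adjoint {S T : H →L[ℂ] H} (h : IsCommutator A S T) :
    IsCommutator A (ContinuousLinearMap.adjoint S) (-ContinuousLinearMap.adjoint T) := by
  intro φ ψ
  have h1 := congrArg (starRingEnd ℂ) (h ψ φ)
  rw [commForm, map_sub, inner_conj_symm, inner_conj_symm, inner_conj_symm] at h1
  rw [commForm, neg_apply, inner_neg_right, ContinuousLinearMap.adjoint_inner_right,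
    ContinuousLinearMap.adjoint_inner_right, ContinuousLinearMap.adjoint_inner_right, h1]
  ring

/-- The iterated commutators of a self-adjoint operator are alternately self-adjoint and
anti-self-adjoint. -/
theorem adjoint_ad (hA : IsSelfAdjoint A) {B : H →L[ℂ] H} (hB : IsSelfAdjoint B) {n : ℕ}
    (h : HasBoundedAd A B n) {k : ℕ} (hk : k ≤ n) :
    ContinuousLinearMap.adjoint (ad A B k) = (-1 : ℂ) ^ k • ad A B k := by
  induction k with
  | zero => simpa [ad] using hB.adjoint_eq
  | succ k ih =>
    have h1 := (isCommutator_ad h (Nat.lt_of_succ_le hk)).neg_adjoint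
    rw [ih (by omega)] at h1
    have h2 := isCommutator_unique hA.dense_domain h1
      ((isCommutator_ad h (Nat.lt_of_succ_le hk)).smul ((-1) ^ k))
    rw [neg_eq_iff_eq_neg] at h2
    rw [h2, pow_succ, mul_neg_one, neg_smul]

end GroupCommutators

/-! ### Fourier representation of the functions -/

section FourierRepresentation

open scoped FourierTransform

/-- An integrable approximate identity whose Fourier transform is a smooth function of compact
support that equals `1` near the origin. -/
theorem exists_bandlimited_kernel : ∃ (ψ : ℝ → ℝ) (K : ℝ → ℂ) (C : ℝ), ContDiff ℝ ∞ ψ ∧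
    (∀ s, |s| ≤ 1 → ψ s = 1) ∧ (∀ s, 2 ≤ |s| → ψ s = 0) ∧ (∀ s, |ψ s| ≤ 1) ∧ Continuous K ∧
    (∀ t, ‖K t‖ ≤ C * (1 + t ^ 2)⁻¹) ∧ ∫ t, K t = 1 ∧
    ∀ x : ℝ, (1 / (2 * Real.pi) : ℂ) * ∫ s : ℝ, ψ s * Complex.exp (-(Complex.I * s * x)) = K x := by
  let β : ContDiffBump (0 : ℝ) := ⟨1, 2, one_pos, one_lt_two⟩
  have hsm : ContDiff ℝ ∞ fun s : ℝ => ((β s : ℝ) : ℂ) :=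
    Complex.ofRealCLM.contDiff.comp β.contDiff
  have hcs : HasCompactSupport fun s : ℝ => ((β s : ℝ) : ℂ) :=
    β.hasCompactSupport.comp_left (g := fun r : ℝ => (r : ℂ)) Complex.ofReal_zero
  let Ψ : SchwartzMap ℝ ℂ := hcs.toSchwartzMap hsm
  let κ : SchwartzMap ℝ ℂ := 𝓕 Ψ
  have hπ : (0 : ℝ) < 2 * Real.pi := by positivity
  have hκ : ∀ x : ℝ, ∫ s : ℝ, ((β s : ℝ) : ℂ) * Complex.exp (-(Complex.I * s * x))
      = κ (x / (2 * Real.pi)) := by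
    intro x
    change _ = (𝓕 Ψ) (x / (2 * Real.pi))
    rw [SchwartzMap.fourier_coe, Real.fourier_real_eq_integral_exp_smul]
    congr 1
    ext s
    rw [smul_eq_mul, mul_comm]
    change _ = _ * ((β s : ℝ) : ℂ)
    congr 2
    have : (Real.pi : ℂ) ≠ 0 := by exact_mod_cast Real.pi_ne_zero
    push_cast
    field_simp
  obtain ⟨C₀, -, hC₀⟩ := κ.decay 0 0
  obtain ⟨C₂, -, hC₂⟩ := κ.decay 2 0
  have hκd : ∀ t : ℝ, ‖κ t‖ * (1 + t ^ 2) ≤ C₀ + C₂ := fun t => by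
    have h1 := hC₀ t
    have h2 := hC₂ t
    simp only [norm_iteratedFDeriv_zero, pow_zero, one_mul, Real.norm_eq_abs, sq_abs] at h1 h2
    linarith
  have hκi : ∫ t, κ t = 1 := by
    have h1 : (𝓕⁻ κ) 0 = Ψ 0 := by rw [show 𝓕⁻ κ = Ψ from FourierTransform.fourierInv_fourier_eq Ψ]
    rw [SchwartzMap.fourierInv_coe, Real.fourierInv_eq'] at h1
    have h2 : Ψ 0 = 1 := by
      change ((β 0 : ℝ) : ℂ) = 1
      rw [β.one_of_mem_closedBall (by simp [β])]
      simp
    rw [h2] at h1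
    simpa using h1
  refine ⟨β, fun x => (1 / (2 * Real.pi) : ℂ) * κ (x / (2 * Real.pi)),
    (C₀ + C₂) * (2 * Real.pi) , β.contDiff, fun s hs => ?_, fun s hs => ?_, fun s => ?_, ?_,
    fun t => ?_, ?_, fun x => by rw [hκ]⟩
  · exact β.one_of_mem_closedBall (by simpa [β] using hs)
  · exact β.zero_of_le_dist (by simpa [β] using hs)
  · rw [abs_of_nonneg (β.nonneg)]
    exact β.le_one
  · have := κ.continuous
    fun_prop
  · have h1 := hκd (t / (2 * Real.pi))
    have h2 : (1 : ℝ) ≤ 2 * Real.pi := by linarith [Real.pi_gt_three]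
    have e : ‖(1 / (2 * Real.pi) : ℂ)‖ = (2 * Real.pi)⁻¹ := by
      rw [show (1 / (2 * Real.pi) : ℂ) = (((2 * Real.pi)⁻¹ : ℝ) : ℂ) by push_cast; ring,
        Complex.norm_real, Real.norm_of_nonneg (by positivity)]
    rw [norm_mul, e, ← div_eq_mul_inv, le_div_iff₀ (by positivity)]
    have h3 : 1 + t ^ 2 ≤ (2 * Real.pi) ^ 2 * (1 + (t / (2 * Real.pi)) ^ 2) := by
      have : (2 * Real.pi) ^ 2 * (1 + (t / (2 * Real.pi)) ^ 2) = (2 * Real.pi) ^ 2 + t ^ 2 := by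
        field_simp
      rw [this]
      nlinarith
    calc (2 * Real.pi)⁻¹ * ‖κ (t / (2 * Real.pi))‖ * (1 + t ^ 2)
        ≤ (2 * Real.pi)⁻¹ * ‖κ (t / (2 * Real.pi))‖
          * ((2 * Real.pi) ^ 2 * (1 + (t / (2 * Real.pi)) ^ 2)) := by gcongr
      _ = ‖κ (t / (2 * Real.pi))‖ * (1 + (t / (2 * Real.pi)) ^ 2) * (2 * Real.pi) := by
          field_simp
      _ ≤ (C₀ + C₂) * (2 * Real.pi) := by gcongr
  · rw [integral_const_mul, Measure.integral_comp_div (fun t => κ t), hκi,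
      abs_of_pos hπ]
    have : (Real.pi : ℂ) ≠ 0 := by exact_mod_cast Real.pi_ne_zero
    rw [Complex.real_smul]
    push_cast
    field_simp

theorem integrable_of_decay {K : ℝ → ℂ} (hK : Continuous K) {C : ℝ}
    (hd : ∀ t, ‖K t‖ ≤ C * (1 + t ^ 2)⁻¹) : Integrable K :=
  (integrable_inv_one_add_sq.const_mul C).mono' hK.aestronglyMeasurable (Eventually.of_forall hd)

theorem integral_sub_sub_sub {f₁ f₂ f₃ f₄ : ℝ → ℂ} (h₁ : Integrable f₁) (h₂ : Integrable f₂)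
    (h₃ : Integrable f₃) (h₄ : Integrable f₄) :
    ∫ x, (f₁ x - f₂ x - (f₃ x - f₄ x))
      = (∫ x, f₁ x) - (∫ x, f₂ x) - ((∫ x, f₃ x) - ∫ x, f₄ x) := by
  rw [← integral_sub h₁ h₂, ← integral_sub h₃ h₄]
  exact integral_sub (h₁.sub h₂) (h₃.sub h₄)

/-- The mean of a bounded function over a kernel concentrated near a point tends to the value
there. -/
theorem tendsto_integral_concentrated {f K : ℝ → ℂ} (hf : Continuous f) {M : ℝ}
    (hM : ∀ x, ‖f x‖ ≤ M) (hK : Integrable K) (y : ℝ) :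
    Tendsto (fun a : ℝ => ∫ t, f (y + a⁻¹ * t) * K t) atTop (𝓝 (f y * ∫ t, K t)) := by
  rw [← integral_const_mul]
  refine tendsto_integral_filter_of_dominated_convergence (fun t => M * ‖K t‖)
    (Eventually.of_forall fun a => ?_)
    (Eventually.of_forall fun a => Eventually.of_forall fun t => ?_)
    (hK.norm.const_mul M) (Eventually.of_forall fun t => ?_)
  · exact (Continuous.aestronglyMeasurable (by fun_prop)).mul hK.aestronglyMeasurable
  · rw [norm_mul]; gcongr; exact hM _
  · refine Tendsto.mul_const _ ((hf.tendsto' y _ rfl).comp ?_)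
    simpa using (tendsto_inv_atTop_zero.mul_const t).const_add y

/-- The mean of a bounded function over a spread-out kernel becomes insensitive to translations. -/
theorem tendsto_integral_spread {f K : ℝ → ℂ} (hf : Continuous f) {M : ℝ}
    (hM : ∀ x, ‖f x‖ ≤ M) (hK : Continuous K) {C : ℝ} (hd : ∀ t, ‖K t‖ ≤ C * (1 + t ^ 2)⁻¹)
    (y : ℝ) :
    Tendsto (fun a : ℝ => (∫ t, f (y + a * t) * K t) - ∫ t, f (0 + a * t) * K t) atTop (𝓝 0) := by
  have hM0 : 0 ≤ M := (norm_nonneg _).trans (hM 0)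
  have hC0 : 0 ≤ C := by simpa using (norm_nonneg _).trans (hd 0)
  have hKi := integrable_of_decay hK hd
  have hi : ∀ a h : ℝ, Integrable fun t => f (a * t) * K (t - h) := fun a h =>
    ((hKi.comp_sub_right h).norm.const_mul M).mono'
      (Continuous.aestronglyMeasurable (by fun_prop))
      (Eventually.of_forall fun t => by rw [norm_mul]; gcongr; exact hM _)
  have e : ∀ᶠ a : ℝ in atTop, ∫ t, f (a * t) * (K (t - y * a⁻¹) - K t)
      = (∫ t, f (y + a * t) * K t) - ∫ t, f (0 + a * t) * K t := by
    filter_upwards [eventually_gt_atTop 0] with a ha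
    have h1 : ∫ t, f (y + a * t) * K t = ∫ t, f (a * t) * K (t - y * a⁻¹) := by
      rw [← integral_sub_right_eq_self (fun t => f (y + a * t) * K t) (y * a⁻¹)]
      congr 1
      ext t
      congr 2
      field_simp
      ring
    rw [h1, ← integral_sub (hi _ _) (by simpa using hi a 0)]
    congr 1
    ext t
    rw [zero_add, mul_sub]
  refine Tendsto.congr' e ?_
  rw [← integral_zero ℝ ℂ]
  refine tendsto_integral_filter_of_dominated_convergence
    (fun t => M * (C * (2 * (1 + y ^ 2)) * (1 + t ^ 2)⁻¹ + C * (1 + t ^ 2)⁻¹))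
    (Eventually.of_forall fun a => Continuous.aestronglyMeasurable (by fun_prop)) ?_ ?_
    (Eventually.of_forall fun t => ?_)
  · filter_upwards [eventually_ge_atTop 1] with a ha
    refine Eventually.of_forall fun t => ?_
    rw [norm_mul]
    refine mul_le_mul (hM _) ((norm_sub_le _ _).trans (add_le_add ((hd _).trans ?_) (hd t)))
      (norm_nonneg _) hM0
    rw [mul_assoc]
    refine mul_le_mul_of_nonneg_left ?_ hC0
    rw [inv_eq_one_div, ← div_eq_mul_inv (2 * (1 + y ^ 2)),
      div_le_div_iff₀ (by positivity) (by positivity)]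
    have h1 : (y * a⁻¹) ^ 2 ≤ y ^ 2 := by
      rw [mul_pow]
      refine mul_le_of_le_one_right (sq_nonneg y) (pow_le_one₀ (by positivity) ?_)
      exact inv_le_one_of_one_le₀ ha
    nlinarith [sq_nonneg (t - 2 * (y * a⁻¹)), mul_nonneg (sq_nonneg y) (sq_nonneg (t - y * a⁻¹))]
  · exact ((integrable_inv_one_add_sq.const_mul _).add
      (integrable_inv_one_add_sq.const_mul _)).const_mul M
  · have h1 : Tendsto (fun a : ℝ => K (t - y * a⁻¹) - K t) atTop (𝓝 0) := by
      rw [← sub_self (K t)]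
      refine ((hK.tendsto' t _ rfl).comp ?_).sub_const _
      simpa using (tendsto_inv_atTop_zero.const_mul y).const_sub t
    refine squeeze_zero_norm (a := fun a => M * ‖K (t - y * a⁻¹) - K t‖) (fun a => ?_) ?_
    · rw [norm_mul]; gcongr; exact hM _
    · simpa using h1.norm.const_mul M

theorem integral_mul_scaled_kernel (f K : ℝ → ℂ) {c : ℝ} (hc : 0 < c) (y : ℝ) :
    ∫ x, f x * ((c⁻¹ : ℝ) * K (c⁻¹ * (x - y))) = ∫ t, f (y + c * t) * K t := by
  have h1 := integral_sub_right_eq_self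
    (fun x => f (y + x) * (((c⁻¹ : ℝ) : ℂ) * K (c⁻¹ * x))) y (μ := volume)
  simp only [add_sub_cancel] at h1
  rw [h1]
  have h2 := Measure.integral_comp_mul_left (fun t => f (y + c * t) * (((c⁻¹ : ℝ) : ℂ) * K t)) c⁻¹
  have e : ∀ x, c * (c⁻¹ * x) = x := fun x => by field_simp
  simp only [e] at h2
  rw [h2, inv_inv, abs_of_pos hc, ← integral_smul]
  congr 1
  ext t
  rw [Complex.real_smul]
  have : (c : ℂ) ≠ 0 := by exact_mod_cast hc.ne'
  push_cast
  field_simp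

theorem integrable_mul_scaled_kernel {f K : ℝ → ℂ} (hf : Continuous f) {M : ℝ}
    (hM : ∀ x, ‖f x‖ ≤ M) (hK : Integrable K) {c : ℝ} (hc : 0 < c) (y : ℝ) :
    Integrable fun x => f x * ((c⁻¹ : ℝ) * K (c⁻¹ * (x - y))) := by
  have h1 : Integrable fun x => ((c⁻¹ : ℝ) : ℂ) * K (c⁻¹ * (x - y)) :=
    ((hK.comp_mul_left' (inv_ne_zero hc.ne')).comp_sub_right y).const_mul _
  refine (h1.norm.const_mul M).mono' (hf.aestronglyMeasurable.mul h1.aestronglyMeasurable)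
    (Eventually.of_forall fun x => ?_)
  rw [norm_mul]
  gcongr
  exact hM x

theorem norm_exp_sub_one_le (s x : ℝ) : ‖Complex.exp (Complex.I * s * x) - 1‖ ≤ |s| * |x| := by
  have := Real.norm_exp_I_mul_ofReal_sub_one_le (x := s * x)
  rw [mul_assoc, ← Complex.ofReal_mul, ← abs_mul]
  exact this

theorem contDiff_exp_sub_one (y : ℝ) :
    ContDiff ℝ ∞ fun s : ℝ => Complex.exp (Complex.I * s * y) - 1 := by
  have : ContDiff ℝ ∞ fun s : ℝ => (s : ℂ) := Complex.ofRealCLM.contDiff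
  fun_prop

/-- A bounded function whose Fourier transform has the density `g` away from the origin is
`f 0 + ∫ g s (exp (i s x) - 1) ds`, provided that `|s| g s` is integrable: there is no contribution
of the origin besides the constant. -/
theorem eq_integral_of_isFourierDensity {f g : ℝ → ℂ} (hf : Continuous f) {M : ℝ}
    (hM : ∀ x, ‖f x‖ ≤ M) (hfg : IsFourierDensity f g) (hg : AEStronglyMeasurable g)
    (hgi : Integrable fun s => ‖g s‖ * |s|) (y : ℝ) :
    f y = f 0 + ∫ s, g s * (Complex.exp (Complex.I * s * y) - 1) := by
  obtain ⟨ψ, K, C, hψ, hψ1, hψ2, hψb, hK, hd, hK1, hψK⟩ := exists_bandlimited_kernel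
  have hKi := integrable_of_decay hK hd
  have hψc : ∀ c : ℝ, ContDiff ℝ ∞ fun s => ((ψ (c * s) : ℝ) : ℂ) := fun c =>
    Complex.ofRealCLM.contDiff.comp (hψ.comp (by fun_prop))
  have hcs : ∀ c : ℝ, 0 < c → HasCompactSupport fun s => ((ψ (c * s) : ℝ) : ℂ) := fun c hc => by
    refine HasCompactSupport.of_support_subset_isCompact
      (isCompact_Icc (a := -(2 / c)) (b := 2 / c)) fun s hs => ?_
    by_contra h
    refine hs ?_
    simp only [Complex.ofReal_eq_zero]
    apply hψ2
    rw [Set.mem_Icc, ← abs_le, not_le, div_lt_iff₀ hc] at h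
    rw [abs_mul, abs_of_pos hc]
    linarith
  -- The inverse transforms of the cut-off functions.
  have hFT : ∀ c : ℝ, 0 < c → ∀ x : ℝ, (1 / (2 * Real.pi) : ℂ)
      * ∫ s : ℝ, ((ψ (c * s) : ℝ) : ℂ) * Complex.exp (-(Complex.I * s * x))
      = (c⁻¹ : ℝ) * K (c⁻¹ * x) := by
    intro c hc x
    have h1 := Measure.integral_comp_mul_left (fun s : ℝ => ((ψ s : ℝ) : ℂ)
      * Complex.exp (-(Complex.I * s * ((c⁻¹ * x : ℝ) : ℂ)))) c
    rw [← hψK, abs_of_pos (inv_pos.mpr hc), Complex.real_smul] at *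
    rw [mul_left_comm, ← h1]
    congr 2
    ext s
    congr 3
    have : (c : ℂ) ≠ 0 := by exact_mod_cast hc.ne'
    push_cast
    field_simp
  have hint : ∀ c : ℝ, 0 < c → ∀ x : ℝ,
      Integrable fun s : ℝ => ((ψ (c * s) : ℝ) : ℂ) * Complex.exp (-(Complex.I * s * x)) :=
    fun c hc x => Continuous.integrable_of_hasCompactSupport
      ((hψc c).continuous.mul (by fun_prop)) (hcs c hc).mul_right
  -- The cut-offs restrict the frequencies to the range from `1 / a` to `a`, roughly, and the second
  -- factor makes the integral against `g` converge as `a → ∞`.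
  let φ : ℝ → ℝ → ℂ := fun a s =>
    (((ψ (a⁻¹ * s) : ℝ) : ℂ) - ((ψ (a * s) : ℝ) : ℂ)) * (Complex.exp (Complex.I * s * y) - 1)
  have hφFT : ∀ a : ℝ, 0 < a → ∀ x : ℝ, (1 / (2 * Real.pi) : ℂ)
      * ∫ s : ℝ, φ a s * Complex.exp (-(Complex.I * s * x))
      = ((a⁻¹⁻¹ : ℝ) * K (a⁻¹⁻¹ * (x - y)) - (a⁻¹⁻¹ : ℝ) * K (a⁻¹⁻¹ * (x - 0)))
        - ((a⁻¹ : ℝ) * K (a⁻¹ * (x - y)) - (a⁻¹ : ℝ) * K (a⁻¹ * (x - 0))) := by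
    intro a ha x
    have ha' := inv_pos.mpr ha
    rw [← hFT _ ha', ← hFT _ ha', ← hFT _ ha, ← hFT _ ha, ← mul_sub, ← mul_sub, ← mul_sub,
      ← integral_sub_sub_sub (hint _ ha' _) (hint _ ha' _) (hint _ ha _) (hint _ ha _)]
    congr 2
    ext s
    have e : Complex.exp (-(Complex.I * s * ((x - y : ℝ) : ℂ)))
        = Complex.exp (Complex.I * s * y) * Complex.exp (-(Complex.I * s * x)) := by
      rw [← Complex.exp_add]
      congr 1
      push_cast
      ring
    simp only [e, φ, sub_zero]
    ring
  have hkey : ∀ a : ℝ, 1 ≤ a → ((∫ t, f (y + a⁻¹ * t) * K t) - ∫ t, f (0 + a⁻¹ * t) * K t)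
      - ((∫ t, f (y + a * t) * K t) - ∫ t, f (0 + a * t) * K t) = ∫ s, g s * φ a s := by
    intro a ha1
    have ha : 0 < a := by linarith
    have ha' := inv_pos.mpr ha
    rw [← hfg.2 (φ a)]
    · simp only [hφFT a ha, mul_sub (f _)]
      have hi := fun (c : ℝ) (hc : 0 < c) y => integrable_mul_scaled_kernel hf hM hKi hc y
      rw [integral_sub_sub_sub (hi _ ha' _) (hi _ ha' _) (hi _ ha _) (hi _ ha _),
        integral_mul_scaled_kernel f K ha', integral_mul_scaled_kernel f K ha',
        integral_mul_scaled_kernel f K ha, integral_mul_scaled_kernel f K ha]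
    · exact ((hψc _).sub (hψc _)).mul (contDiff_exp_sub_one y)
    · exact ((hcs _ ha').sub (hcs _ ha)).mul_right
    · -- Near the origin both cut-off functions are equal to `1`.
      rw [notMem_tsupport_iff_eventuallyEq]
      filter_upwards [Metric.ball_mem_nhds (0 : ℝ) ha'] with s hs
      have h1 : |s| < a⁻¹ := by simpa using hs
      have h2 : a⁻¹ ≤ 1 := inv_le_one_of_one_le₀ ha1
      have h3 : |a⁻¹ * s| ≤ 1 := by
        rw [abs_mul, abs_of_pos ha']
        exact mul_le_one₀ h2 (abs_nonneg s) (by linarith)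
      have h4 : |a * s| ≤ 1 := by
        rw [abs_mul, abs_of_pos ha]
        calc a * |s| ≤ a * a⁻¹ := by gcongr
          _ = 1 := mul_inv_cancel₀ ha.ne'
      simp [φ, hψ1 _ h3, hψ1 _ h4]
  have hL : Tendsto (fun a : ℝ => ((∫ t, f (y + a⁻¹ * t) * K t) - ∫ t, f (0 + a⁻¹ * t) * K t)
      - ((∫ t, f (y + a * t) * K t) - ∫ t, f (0 + a * t) * K t)) atTop (𝓝 (f y - f 0)) := by
    have h := ((tendsto_integral_concentrated hf hM hKi y).sub
      (tendsto_integral_concentrated hf hM hKi 0)).sub (tendsto_integral_spread hf hM hK hd y)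
    simpa [hK1] using h
  have hR : Tendsto (fun a : ℝ => ∫ s, g s * φ a s) atTop
      (𝓝 (∫ s, g s * (Complex.exp (Complex.I * s * y) - 1))) := by
    refine tendsto_integral_filter_of_dominated_convergence (fun s => 2 * |y| * (‖g s‖ * |s|))
      (Eventually.of_forall fun a => hg.mul (Continuous.aestronglyMeasurable ?_))
      (Eventually.of_forall fun a => Eventually.of_forall fun s => ?_) (hgi.const_mul _) ?_
    · exact ((hψc _).continuous.sub (hψc _).continuous).mul (contDiff_exp_sub_one y).continuous
    · have h1 : ‖((ψ (a⁻¹ * s) : ℝ) : ℂ) - ((ψ (a * s) : ℝ) : ℂ)‖ ≤ 2 := by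
        refine (norm_sub_le _ _).trans ?_
        rw [Complex.norm_real, Complex.norm_real, Real.norm_eq_abs, Real.norm_eq_abs]
        linarith [hψb (a⁻¹ * s), hψb (a * s)]
      rw [norm_mul, norm_mul]
      calc ‖g s‖ * (‖((ψ (a⁻¹ * s) : ℝ) : ℂ) - ((ψ (a * s) : ℝ) : ℂ)‖
            * ‖Complex.exp (Complex.I * s * y) - 1‖) ≤ ‖g s‖ * (2 * (|s| * |y|)) := by
            gcongr
            exact norm_exp_sub_one_le s y
        _ = 2 * |y| * (‖g s‖ * |s|) := by ring
    · have h0 : ∀ᵐ s : ℝ, s ≠ 0 := by simp [ae_iff]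
      filter_upwards [h0] with s hs
      refine tendsto_const_nhds.congr' ?_
      have h1 : ∀ᶠ a : ℝ in atTop, 2 / |s| ≤ a := eventually_ge_atTop _
      have h2 : ∀ᶠ a : ℝ in atTop, |s| ≤ a := eventually_ge_atTop _
      filter_upwards [h1, h2, eventually_gt_atTop 0] with a ha1 ha2 ha
      have hs' : 0 < |s| := abs_pos.mpr hs
      rw [div_le_iff₀ hs'] at ha1
      have h3 : |a⁻¹ * s| ≤ 1 := by
        rw [abs_mul, abs_of_pos (inv_pos.mpr ha)]
        calc a⁻¹ * |s| ≤ a⁻¹ * a := by gcongr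
          _ = 1 := inv_mul_cancel₀ ha.ne'
      have h4 : 2 ≤ |a * s| := by rwa [abs_mul, abs_of_pos ha]
      simp [φ, hψ1 _ h3, hψ2 _ h4]
  have h := tendsto_nhds_unique (hL.congr' (by
    filter_upwards [eventually_ge_atTop 1] with a ha using hkey a ha)) hR
  rw [← h]
  ring

/-- The function `f` is bounded and continuous, and it is represented by the density `g`, whose
moments of the orders `1, …, n` are finite. The difference `exp (i s x) - 1` compensates for the
singularity that `g` may have at the origin. -/
structure FourierRep (n : ℕ) (f g : ℝ → ℂ) : Prop where
  continuous : Continuous f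
  bounded : ∃ M : ℝ, ∀ x, ‖f x‖ ≤ M
  measurable : AEStronglyMeasurable g
  integrable : ∀ k : ℕ, 1 ≤ k → k ≤ n → Integrable (fun s : ℝ => ‖g s‖ * |s| ^ k)
  eq_integral : ∀ x : ℝ, f x = f 0 + ∫ s, g s * (Complex.exp (Complex.I * s * x) - 1)

theorem MemB.isFourierDensity {n : ℕ} {f : ℝ → ℂ} (hf : MemB n f) :
    IsFourierDensity f (fhat f) := by
  rw [fhat, dif_pos hf.hasDensity]
  exact hf.hasDensity.choose_spec

theorem MemB.fourierRep {n : ℕ} (hn : 1 ≤ n) {f : ℝ → ℂ} (hf : MemB n f) :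
    FourierRep n f (fhat f) := by
  have hg : AEStronglyMeasurable (fhat f) := by
    simpa [restrict_compl_singleton] using hf.isFourierDensity.1.aestronglyMeasurable
  obtain ⟨M, hM⟩ := hf.bounded
  refine ⟨hf.smooth.continuous, hf.bounded, hg, hf.integrable, fun x => ?_⟩
  exact eq_integral_of_isFourierDensity hf.smooth.continuous hM hf.isFourierDensity hg
    (by simpa using hf.integrable 1 le_rfl hn) x

theorem FourierRep.conj {n : ℕ} {f g : ℝ → ℂ} (h : FourierRep n f g) :
    FourierRep n (fun x => star (f x)) (fun s => star (g (-s))) where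
  continuous := h.continuous.star
  bounded := by simpa using h.bounded
  measurable := (h.measurable.comp_quasiMeasurePreserving
    (Measure.measurePreserving_neg volume).quasiMeasurePreserving).star
  integrable k hk hkn := by simpa using (h.integrable k hk hkn).comp_neg
  eq_integral x := by
    rw [h.eq_integral x, star_add]
    congr 1
    rw [← integral_neg_eq_self, Complex.star_def, ← integral_conj]
    congr 1
    ext s
    rw [map_mul, map_sub, ← Complex.exp_conj]
    simp

theorem hasDerivAt_integral_exp {w : ℝ → ℂ} (hw : AEStronglyMeasurable w)
    (hwi : Integrable fun s => ‖w s‖ * |s|) (c : ℂ) (x : ℝ)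
    (hx : Integrable fun s => w s * (Complex.exp (Complex.I * s * x) - c)) :
    HasDerivAt (fun x : ℝ => ∫ s, w s * (Complex.exp (Complex.I * s * x) - c))
      (∫ s, w s * (Complex.I * s) * Complex.exp (Complex.I * s * x)) x := by
  refine (hasDerivAt_integral_of_dominated_loc_of_deriv_le (bound := fun s => ‖w s‖ * |s|)
    (F := fun (x : ℝ) (s : ℝ) => w s * (Complex.exp (Complex.I * s * x) - c))
    (F' := fun (x : ℝ) (s : ℝ) => w s * (Complex.I * s) * Complex.exp (Complex.I * s * x))
    univ_mem (Eventually.of_forall fun y => ?_) hx ?_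
    (Eventually.of_forall fun s y _ => ?_) hwi (Eventually.of_forall fun s y _ => ?_)).2
  · exact hw.mul (Continuous.aestronglyMeasurable (by fun_prop))
  · exact (hw.mul (Continuous.aestronglyMeasurable (by fun_prop))).mul
      (Continuous.aestronglyMeasurable (by fun_prop))
  · have h1 : ‖Complex.exp (Complex.I * s * y)‖ = 1 := by
      rw [mul_assoc, mul_comm, ← Complex.ofReal_mul, Complex.norm_exp_ofReal_mul_I]
    simp [h1]
  · have h1 := ((((hasDerivAt_id y).ofReal_comp.const_mul
      (Complex.I * s)).cexp).sub_const c).const_mul (w s)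
    refine h1.congr_deriv ?_
    simp
    ring

theorem FourierRep.aestronglyMeasurable_moment {n : ℕ} {f g : ℝ → ℂ} (h : FourierRep n f g)
    (k : ℕ) : AEStronglyMeasurable fun s : ℝ => g s * (Complex.I * s) ^ k :=
  h.measurable.mul (Continuous.aestronglyMeasurable (by fun_prop))

theorem norm_mul_I_mul_pow (z : ℂ) (s : ℝ) (k : ℕ) : ‖z * (Complex.I * s) ^ k‖ = ‖z‖ * |s| ^ k := by
  simp

theorem FourierRep.integrable_exp_sub_one {n : ℕ} (hn : 1 ≤ n) {f g : ℝ → ℂ} (h : FourierRep n f g)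
    (x : ℝ) : Integrable fun s : ℝ => g s * (Complex.exp (Complex.I * s * x) - 1) := by
  refine ((h.integrable 1 le_rfl hn).mul_const |x|).mono' (h.measurable.mul
    (Continuous.aestronglyMeasurable (by fun_prop))) (Eventually.of_forall fun s => ?_)
  rw [norm_mul, pow_one, mul_assoc ‖g s‖]
  gcongr
  exact norm_exp_sub_one_le s x

theorem FourierRep.iteratedDeriv_eq {n : ℕ} {f g : ℝ → ℂ} (h : FourierRep n f g) {k : ℕ}
    (hk : 1 ≤ k) (hkn : k ≤ n) : iteratedDeriv k f = fun x : ℝ =>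
      ∫ s, g s * (Complex.I * s) ^ k * Complex.exp (Complex.I * s * x) := by
  induction k, hk using Nat.le_induction with
  | base =>
    have hi : Integrable fun s => ‖g s‖ * |s| := by simpa using h.integrable 1 le_rfl hkn
    rw [iteratedDeriv_one]
    ext x
    have h1 := (hasDerivAt_integral_exp h.measurable hi 1 x
      (h.integrable_exp_sub_one hkn x)).const_add (f 0)
    simp only [← h.eq_integral] at h1
    rw [h1.deriv]
    simp
  | succ k hk ih =>
    rw [iteratedDeriv_succ, ih (by omega)]
    ext x
    have h0 := h.aestronglyMeasurable_moment k
    have h1 := hasDerivAt_integral_exp h0 ?_ 0 x ?_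
    · simp only [sub_zero] at h1
      rw [h1.deriv]
      congr 1
      ext s
      ring
    · simp only [norm_mul_I_mul_pow]
      refine (h.integrable (k + 1) (by omega) hkn).congr (Eventually.of_forall fun s => ?_)
      simp only
      ring
    · refine (h.integrable k hk (by omega)).mono'
        (h0.mul (Continuous.aestronglyMeasurable (by fun_prop))) (Eventually.of_forall fun s => ?_)
      have h2 : ‖Complex.exp (Complex.I * s * x)‖ = 1 := by
        rw [mul_assoc Complex.I, mul_comm Complex.I, ← Complex.ofReal_mul,
          Complex.norm_exp_ofReal_mul_I]
      rw [sub_zero, norm_mul, norm_mul_I_mul_pow, h2, mul_one]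

theorem iteratedDeriv_star (f : ℝ → ℂ) (k : ℕ) :
    iteratedDeriv k (fun x => star (f x)) = fun x => star (iteratedDeriv k f x) := by
  induction k with
  | zero => simp
  | succ k ih => rw [iteratedDeriv_succ, ih, iteratedDeriv_succ, deriv.star']

end FourierRepresentation

/-! ### The commutator with a function of the operator -/

section CommutatorFormulas

variable {H : Type*} [NormedAddCommGroup H] [InnerProductSpace ℂ H] [CompleteSpace H]
  {A : H →ₗ.[ℂ] H} {n : ℕ} {f g : ℝ → ℂ}

theorem continuous_uncurry_exp :
    Continuous (Function.uncurry fun s x : ℝ => Complex.exp (Complex.I * s * x)) := by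
  unfold Function.uncurry
  fun_prop

theorem FourierRep.integrable_moment_smul_expI (hA : IsSelfAdjoint A) (h : FourierRep n f g) {k : ℕ}
    (hk : 1 ≤ k) (hkn : k ≤ n) (y : H) :
    Integrable fun s => (g s * (Complex.I * s) ^ k) • expI A s y :=
  integrable_smul_funcCalc hA continuous_uncurry_exp (continuous_const (y := (1 : ℝ)))
    norm_exp_I_mul_le (h.aestronglyMeasurable_moment k)
    (by simpa only [norm_mul_I_mul_pow, mul_one] using h.integrable k hk hkn) y

theorem FourierRep.funcCalc_iteratedDeriv_apply (hA : IsSelfAdjoint A) (h : FourierRep n f g)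
    {k : ℕ} (hk : 1 ≤ k) (hkn : k ≤ n) (y : H) :
    funcCalc A (iteratedDeriv k f) y = ∫ s, (g s * (Complex.I * s) ^ k) • expI A s y :=
  funcCalc_integral hA continuous_uncurry_exp (continuous_const (y := (1 : ℝ)))
    norm_exp_I_mul_le (h.aestronglyMeasurable_moment k)
    (by simpa only [norm_mul_I_mul_pow, mul_one] using h.integrable k hk hkn)
    (fun x => congrFun (h.iteratedDeriv_eq hk hkn) x) y

/-- On the domain of `A` one has `f(A) = f 0 + ∫ g s (exp (i s A) - 1) ds`. -/
theorem FourierRep.funcCalc_apply (hA : IsSelfAdjoint A) (hn : 1 ≤ n) (h : FourierRep n f g)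
    (ψ : A.domain) : Integrable (fun s => g s • (expI A s ψ - ψ)) ∧
      funcCalc A f ψ = f 0 • (ψ : H) + ∫ s, g s • (expI A s ψ - ψ) := by
  set y := addScalar A Complex.I ψ with hy
  have hψ : resolventAt A Complex.I y = ψ := resolvent_addScalar hA (Or.inl rfl) ψ
  obtain ⟨M, hM⟩ := h.bounded
  let q : ℝ → ℝ → ℂ := fun s x =>
    (Complex.exp (Complex.I * s * x) + (-1)) * ((x : ℂ) + Complex.I)⁻¹
  have hqc : Continuous (Function.uncurry q) := by
    have h2 : Continuous fun p : ℝ × ℝ => ((p.2 : ℂ) + Complex.I)⁻¹ :=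
      continuous_inv_ofReal_add_I.comp continuous_snd
    exact (continuous_uncurry_exp.add continuous_const).mul h2
  have hqb : ∀ s x, ‖q s x‖ ≤ |s| := fun s x => by
    have h3 : |x| * ‖((x : ℂ) + Complex.I)⁻¹‖ ≤ 1 := by
      rw [norm_inv, ← div_eq_mul_inv]
      refine div_le_one_of_le₀ ?_ (norm_nonneg _)
      simpa using Complex.abs_re_le_norm ((x : ℂ) + Complex.I)
    simp only [q, norm_mul, ← sub_eq_add_neg]
    calc ‖Complex.exp (Complex.I * s * x) - 1‖ * ‖((x : ℂ) + Complex.I)⁻¹‖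
        ≤ |s| * |x| * ‖((x : ℂ) + Complex.I)⁻¹‖ := by gcongr; exact norm_exp_sub_one_le s x
      _ ≤ |s| := by
          rw [mul_assoc]
          exact mul_le_of_le_one_right (abs_nonneg s) h3
  have hq : ∀ s, funcCalc A (q s) y = expI A s ψ - ψ := fun s => by
    rw [funcCalc_add_const_mul_inv hA (continuous_exp_I_mul s) (norm_exp_I_mul_le s), hψ,
      neg_one_smul, ← sub_eq_add_neg]
    rfl
  have hgi : Integrable fun s => ‖g s‖ * |s| := by simpa using h.integrable 1 le_rfl hn
  have h1 := integrable_smul_funcCalc hA hqc continuous_abs hqb h.measurable hgi y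
  have h2 := funcCalc_integral hA hqc continuous_abs hqb h.measurable hgi
    (F := fun x => (f x + (-f 0)) * ((x : ℂ) + Complex.I)⁻¹) (fun x => by
      simp only [q, ← mul_assoc]
      rw [integral_mul_const]
      congr 1
      simp only [← sub_eq_add_neg]
      exact sub_eq_of_eq_add' (h.eq_integral x)) y
  simp only [hq] at h1 h2
  refine ⟨h1, ?_⟩
  rw [← h2, funcCalc_add_const_mul_inv hA h.continuous hM, hψ, neg_smul]
  abel

/-- The adjoint of the formula for `f(A)` on the domain of `A`. -/
theorem FourierRep.inner_funcCalc_apply (hA : IsSelfAdjoint A) (hn : 1 ≤ n) (h : FourierRep n f g)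
    (φ : A.domain) (y : H) : Integrable (fun s => g s * inner ℂ (φ : H) (expI A s y - y)) ∧
      inner ℂ (φ : H) (funcCalc A f y)
        = f 0 * inner ℂ (φ : H) y + ∫ s, g s * inner ℂ (φ : H) (expI A s y - y) := by
  obtain ⟨M, hM⟩ := h.bounded
  set χ := addScalar A (-Complex.I) φ
  have hφ : resolventAt A (-Complex.I) χ = φ := resolvent_addScalar hA (Or.inr rfl) φ
  have hin : ∀ z, inner ℂ (φ : H) z = inner ℂ χ (resolventAt A Complex.I z) := fun z => by
    rw [← hφ, ← adjoint_resolvent hA, ContinuousLinearMap.star_eq_adjoint,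
      ContinuousLinearMap.adjoint_inner_left]
  obtain ⟨hy, -⟩ := resolvent_spec hA (Or.inl rfl) y
  obtain ⟨h1, h2⟩ := h.funcCalc_apply hA hn ⟨_, hy⟩
  have hcf : funcCalc A f (resolventAt A Complex.I y) = resolventAt A Complex.I (funcCalc A f y) :=
    DFunLike.congr_fun (commute_funcCalc_resolvent hA h.continuous hM).eq y
  have hce : ∀ s, expI A s (resolventAt A Complex.I y) = resolventAt A Complex.I (expI A s y) :=
    fun s => DFunLike.congr_fun (commute_funcCalc_resolvent hA (continuous_exp_I_mul s)
      (norm_exp_I_mul_le s)).eq y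
  have e : ∀ s, g s * inner ℂ (φ : H) (expI A s y - y)
      = innerSL ℂ χ (g s • (expI A s (resolventAt A Complex.I y) - resolventAt A Complex.I y)) := by
    intro s
    rw [hin, hce, ← map_sub, map_smul, innerSL_apply_apply, smul_eq_mul]
  simp only [e]
  refine ⟨(innerSL ℂ χ).integrable_comp h1, ?_⟩
  rw [(innerSL ℂ χ).integral_comp_comm h1, hin, hin, ← hcf, h2, inner_add_right, inner_smul_right]
  rfl

/-- The commutator with `f(A)` in terms of the commutators with the unitary group, in the sense of
forms. -/
theorem FourierRep.inner_commutator (hA : IsSelfAdjoint A) (hn : 1 ≤ n) (h : FourierRep n f g)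
    (B : H →L[ℂ] H) (φ ψ : A.domain) :
    Integrable (fun s => g s * inner ℂ (φ : H) (B (expI A s ψ) - expI A s (B ψ))) ∧
      inner ℂ (φ : H) ((B ∘L funcCalc A f - funcCalc A f ∘L B) ψ)
        = ∫ s, g s * inner ℂ (φ : H) (B (expI A s ψ) - expI A s (B ψ)) := by
  obtain ⟨h1, h2⟩ := h.funcCalc_apply hA hn ψ
  obtain ⟨h3, h4⟩ := h.inner_funcCalc_apply hA hn φ (B ψ)
  have h5 := ((innerSL ℂ (φ : H)).comp B).integrable_comp h1
  have e : ∀ s, g s * inner ℂ (φ : H) (B (expI A s ψ) - expI A s (B ψ))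
      = ((innerSL ℂ (φ : H)).comp B) (g s • (expI A s ψ - ψ))
        - g s * inner ℂ (φ : H) (expI A s (B ψ) - B ψ) := by
    intro s
    simp only [ContinuousLinearMap.comp_apply, map_smul, innerSL_apply_apply, map_sub,
      inner_sub_right, smul_eq_mul]
    ring
  simp only [e]
  refine ⟨h5.sub h3, ?_⟩
  rw [integral_sub h5 h3, ContinuousLinearMap.integral_comp_comm _ h1]
  simp only [sub_apply, ContinuousLinearMap.comp_apply, inner_sub_right, h4, h2, map_add, map_smul,
    innerSL_apply_apply, inner_add_right, inner_smul_right]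
  ring

/-- The commutator with `f(A)` as an operator, if the commutator with `A` is bounded. -/
theorem FourierRep.commutator_apply (hA : IsSelfAdjoint A) (hn : 1 ≤ n) (h : FourierRep n f g)
    {B T : H →L[ℂ] H} (hT : IsCommutator A B T) (ψ : H) :
    Integrable (fun s => g s • (B (expI A s ψ) - expI A s (B ψ))) ∧
      (B ∘L funcCalc A f - funcCalc A f ∘L B) ψ
        = ∫ s, g s • (B (expI A s ψ) - expI A s (B ψ)) := by
  let W : ℝ → H →L[ℂ] H := fun s => B ∘L expI A s - expI A s ∘L B
  have hW : ∀ s y, ‖W s y‖ ≤ |s| * ‖T‖ * ‖y‖ := fun s y => by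
    rw [mul_assoc]
    exact norm_commutator_expI_apply_le hA hT s y
  have hWc : ∀ y, Continuous fun s => W s y := fun y =>
    (B.continuous.comp (continuous_expI_apply hA y)).sub (continuous_expI_apply hA (B y))
  have hgi : Integrable fun s => ‖g s‖ * (|s| * ‖T‖) := by
    simpa [mul_assoc] using (h.integrable 1 le_rfl hn).mul_const ‖T‖
  have hint : ∀ y, Integrable fun s => g s • W s y := fun y => by
    refine (hgi.mul_const ‖y‖).mono' (h.measurable.smul (hWc y).aestronglyMeasurable)
      (Eventually.of_forall fun s => ?_)
    rw [norm_smul, mul_assoc]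
    gcongr
    exact hW s y
  have hcont := continuous_integral_smul hW hgi hint
  refine ⟨hint ψ, ?_⟩
  refine congrFun (Continuous.ext_on hA.dense_domain
    (B ∘L funcCalc A f - funcCalc A f ∘L B).continuous hcont fun ψ hψ => ?_) ψ
  refine hA.dense_domain.eq_of_inner_right ℂ fun φ hφ => ?_
  rw [(h.inner_commutator hA hn B ⟨φ, hφ⟩ ⟨ψ, hψ⟩).2, ← innerSL_apply_apply ℂ φ (∫ s, g s • W s ψ),
    ← (innerSL ℂ φ).integral_comp_comm (hint ψ)]
  congr 1
  ext s
  rw [map_smul]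
  rfl

/-- The remainder of the expansion of the commutator `[B, f(A)]` with the functions of `A` on the
left. -/
noncomputable def expansionRemainder (A : H →ₗ.[ℂ] H) (B : H →L[ℂ] H) (n : ℕ) (f : ℝ → ℂ) :
    H →L[ℂ] H :=
  B ∘L funcCalc A f - funcCalc A f ∘L B - ∑ k ∈ Finset.Icc 1 (n - 1), (1 / (k.factorial : ℂ)) •
    (funcCalc A (iteratedDeriv k f) ∘L ad A B k)

theorem FourierRep.expansionRemainder_apply (hA : IsSelfAdjoint A) (hn : 1 ≤ n)
    (h : FourierRep n f g) {B : H →L[ℂ] H} (hB : HasBoundedAd A B n) (ψ : H) :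
    expansionRemainder A B n f ψ = ∫ s, g s • expI A s (taylorRemainder A (ad A B) n s ψ) := by
  obtain ⟨h1, h2⟩ := h.commutator_apply hA hn (B := B) (isCommutator_ad hB (k := 0) hn) ψ
  have h3 : ∀ k ∈ Finset.Icc 1 (n - 1), Integrable fun s =>
      (1 / (k.factorial : ℂ)) • ((g s * (Complex.I * s) ^ k) • expI A s (ad A B k ψ)) := by
    intro k hk
    rw [Finset.mem_Icc] at hk
    exact (h.integrable_moment_smul_expI hA hk.1 (by omega) _).smul _
  have h4 : ∑ k ∈ Finset.Icc 1 (n - 1), ((1 / (k.factorial : ℂ)) •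
      (funcCalc A (iteratedDeriv k f) ∘L ad A B k)) ψ = ∫ s, ∑ k ∈ Finset.Icc 1 (n - 1),
        (1 / (k.factorial : ℂ)) • ((g s * (Complex.I * s) ^ k) • expI A s (ad A B k ψ)) := by
    rw [integral_finsetSum _ h3]
    refine Finset.sum_congr rfl fun k hk => ?_
    rw [Finset.mem_Icc] at hk
    rw [integral_smul, smul_apply, ContinuousLinearMap.comp_apply,
      h.funcCalc_iteratedDeriv_apply hA hk.1 (by omega)]
  have h5 : (∑ k ∈ Finset.Icc 1 (n - 1), (1 / (k.factorial : ℂ)) •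
      (funcCalc A (iteratedDeriv k f) ∘L ad A B k)) ψ = _ :=
    (sum_apply _ _ _).trans h4
  rw [expansionRemainder, sub_apply, h5, h2, ← integral_sub h1 (integrable_finsetSum _ h3)]
  congr 1
  ext s
  have hr : Finset.range n = insert 0 (Finset.Icc 1 (n - 1)) := by
    ext k
    simp only [Finset.mem_range, Finset.mem_insert, Finset.mem_Icc]
    omega
  rw [taylorRemainder, map_sub, expI_apply_expI_neg hA, hr, Finset.sum_insert (by simp), map_add,
    map_sum]
  simp only [map_smul, smul_sub, Finset.smul_sum, pow_zero, Nat.factorial_zero,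
    Nat.cast_one, div_one, one_smul, ad, ← sub_sub]
  congr 1
  refine Finset.sum_congr rfl fun k _ => ?_
  rw [smul_smul, smul_smul]
  congr 1
  ring

theorem FourierRep.norm_expansionRemainder_le (hA : IsSelfAdjoint A) (hn : 1 ≤ n)
    (h : FourierRep n f g) {B : H →L[ℂ] H} (hB : HasBoundedAd A B n) :
    ‖expansionRemainder A B n f‖
      ≤ 1 / n.factorial * ‖ad A B n‖ * ∫ s : ℝ, ‖g s‖ * |s| ^ n := by
  have hpos : 0 ≤ ∫ s : ℝ, ‖g s‖ * |s| ^ n := integral_nonneg fun s => by positivity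
  refine ContinuousLinearMap.opNorm_le_bound _ (by positivity) fun ψ => ?_
  rw [h.expansionRemainder_apply hA hn hB]
  have h1 := (h.integrable n hn le_rfl).const_mul (1 / n.factorial * ‖ad A B n‖ * ‖ψ‖)
  refine (norm_integral_le_of_norm_le h1 (Eventually.of_forall fun s => ?_)).trans (le_of_eq ?_)
  · rw [norm_smul]
    calc ‖g s‖ * ‖expI A s (taylorRemainder A (ad A B) n s ψ)‖
        ≤ ‖g s‖ * (|s| ^ n / n.factorial * (‖ad A B n‖ * ‖ψ‖)) := by
          gcongr
          exact (norm_expI_apply_le hA _ _).trans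
            (norm_taylorRemainder_le hA n (ad A B) (fun k hk => isCommutator_ad hB hk) s ψ)
      _ = 1 / n.factorial * ‖ad A B n‖ * ‖ψ‖ * (‖g s‖ * |s| ^ n) := by ring
  · rw [integral_const_mul]
    ring

theorem FourierRep.adjoint_funcCalc_iteratedDeriv (hA : IsSelfAdjoint A) (h : FourierRep n f g)
    {k : ℕ} (hk : 1 ≤ k) (hkn : k ≤ n) :
    ContinuousLinearMap.adjoint (funcCalc A (iteratedDeriv k fun x => star (f x)))
      = funcCalc A (iteratedDeriv k f) := by
  have hi : Integrable fun s => ‖g s * (Complex.I * s) ^ k‖ := by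
    simpa only [norm_mul_I_mul_pow] using h.integrable k hk hkn
  have hb : ∀ x, ‖iteratedDeriv k f x‖ ≤ ∫ s, ‖g s * (Complex.I * s) ^ k‖ := fun x => by
    rw [h.iteratedDeriv_eq hk hkn]
    refine norm_integral_le_of_norm_le hi (Eventually.of_forall fun s => ?_)
    rw [norm_mul]
    exact mul_le_of_le_one_right (norm_nonneg _) (norm_exp_I_mul_le s x)
  have hc : Continuous (iteratedDeriv k f) := by
    rw [h.iteratedDeriv_eq hk hkn]
    refine continuous_of_dominated (fun x => (h.aestronglyMeasurable_moment k).mul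
      (Continuous.aestronglyMeasurable (by fun_prop))) (fun x => Eventually.of_forall fun s => ?_)
      hi (Eventually.of_forall fun s => by fun_prop)
    rw [norm_mul]
    exact mul_le_of_le_one_right (norm_nonneg _) (norm_exp_I_mul_le s x)
  rw [iteratedDeriv_star, ← star_funcCalc hA hc hb, ← ContinuousLinearMap.star_eq_adjoint,
    star_star]

/-- The expansion with the functions of `A` on the right is the adjoint of the expansion, for the
complex conjugate function, with the functions of `A` on the left. -/
theorem FourierRep.commutator_eq_sub_adjoint (hA : IsSelfAdjoint A) (h : FourierRep n f g)
    {B : H →L[ℂ] H} (hB : IsSelfAdjoint B) (hBn : HasBoundedAd A B n) :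
    B ∘L funcCalc A f - funcCalc A f ∘L B =
      ∑ k ∈ Finset.Icc 1 (n - 1), ((1 / (k.factorial : ℂ)) * (-1) ^ (k - 1)) •
        (ad A B k ∘L funcCalc A (iteratedDeriv k f))
      - ContinuousLinearMap.adjoint (expansionRemainder A B n fun x => star (f x)) := by
  obtain ⟨M, hM⟩ := h.bounded
  have hf : ContinuousLinearMap.adjoint (funcCalc A fun x => star (f x)) = funcCalc A f := by
    rw [← star_funcCalc hA h.continuous hM, ← ContinuousLinearMap.star_eq_adjoint, star_star]
  rw [expansionRemainder, map_sub, map_sub, ContinuousLinearMap.adjoint_comp,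
    ContinuousLinearMap.adjoint_comp, hf, hB.adjoint_eq, map_sum, sub_sub_eq_add_sub,
    ← Finset.sum_add_distrib, Finset.sum_eq_zero]
  · abel
  · intro k hk
    rw [Finset.mem_Icc] at hk
    rw [map_smulₛₗ, ContinuousLinearMap.adjoint_comp,
      h.adjoint_funcCalc_iteratedDeriv hA hk.1 (by omega), adjoint_ad hA hB hBn (by omega : k ≤ n),
      ContinuousLinearMap.smul_comp, smul_smul, ← add_smul]
    obtain ⟨j, rfl⟩ : ∃ j, k = j + 1 := ⟨k - 1, by omega⟩
    simp [pow_succ]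

end CommutatorFormulas

end CommutatorExpansion

theorem mainTheorem6 (n : ℕ) (hn : 1 ≤ n) :
    ∃ c : ℝ, ∀ (H : Type u) [NormedAddCommGroup H] [InnerProductSpace ℂ H] [CompleteSpace H]
      (A : H →ₗ.[ℂ] H) (_ : IsSelfAdjoint A) (B : H →L[ℂ] H) (_ : IsSelfAdjoint B)
      (f : ℝ → ℂ) (_ : MemB n f),
      -- the integral representation, in the sense of forms on the domain of `A`
      (∃ hdom : ∀ (u : ℝ) (ψ : A.domain), expI A u ψ ∈ A.domain,
        ∀ φ ψ : A.domain,
          (∀ s : ℝ, IntervalIntegrable (fun u : ℝ => commForm A B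
            ⟨expI A (-(s - u)) φ, hdom _ φ⟩ ⟨expI A u ψ, hdom u ψ⟩) volume 0 s) ∧
          Integrable (fun s : ℝ => fhat f s * ∫ u in (0 : ℝ)..s, commForm A B
            ⟨expI A (-(s - u)) φ, hdom _ φ⟩ ⟨expI A u ψ, hdom u ψ⟩) ∧
          inner ℂ (φ : H) ((B ∘L funcCalc A f - funcCalc A f ∘L B) ψ) =
            Complex.I * ∫ s : ℝ, fhat f s * ∫ u in (0 : ℝ)..s, commForm A B
              ⟨expI A (-(s - u)) φ, hdom _ φ⟩ ⟨expI A u ψ, hdom u ψ⟩) ∧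
      -- the integral representation, as an operator identity, if `[B, A]` is bounded
      (HasBoundedAd A B 1 → ∀ ψ : H,
        (∀ s : ℝ, IntervalIntegrable (fun u : ℝ =>
          expI A (s - u) (ad A B 1 (expI A u ψ))) volume 0 s) ∧
        Integrable (fun s : ℝ => fhat f s • ∫ u in (0 : ℝ)..s,
          expI A (s - u) (ad A B 1 (expI A u ψ))) ∧
        (B ∘L funcCalc A f - funcCalc A f ∘L B) ψ =
          Complex.I • ∫ s : ℝ, fhat f s • ∫ u in (0 : ℝ)..s,
            expI A (s - u) (ad A B 1 (expI A u ψ))) ∧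
      -- the two expansions
      (HasBoundedAd A B n → ∃ R R' : H →L[ℂ] H,
        B ∘L funcCalc A f - funcCalc A f ∘L B =
          ∑ k ∈ Finset.Icc 1 (n - 1), (1 / (k.factorial : ℂ)) •
            (funcCalc A (iteratedDeriv k f) ∘L ad A B k) + R ∧
        B ∘L funcCalc A f - funcCalc A f ∘L B =
          ∑ k ∈ Finset.Icc 1 (n - 1), ((1 / (k.factorial : ℂ)) * (-1) ^ (k - 1)) •
            (ad A B k ∘L funcCalc A (iteratedDeriv k f)) - ContinuousLinearMap.adjoint R' ∧
        ((∀ x, (f x).im = 0) → R' = R) ∧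
        ‖R‖ ≤ c * ‖ad A B n‖ * ∫ s : ℝ, ‖fhat f s‖ * |s| ^ n ∧
        ‖R'‖ ≤ c * ‖ad A B n‖ * ∫ s : ℝ, ‖fhat f s‖ * |s| ^ n) := by
  refine ⟨1 / n.factorial, fun H _ _ _ A hA B hB f hf => ?_⟩
  have h := hf.fourierRep hn
  have hI : ∀ z w : ℂ, z = Complex.I * w → w = -Complex.I * z := fun z w e => by
    rw [e, ← mul_assoc, neg_mul, Complex.I_mul_I, neg_neg, one_mul]
  refine ⟨⟨expI_mem_domain hA, fun φ ψ => ?_⟩, fun hB1 ψ => ?_, fun hBn => ?_⟩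
  · obtain ⟨h1, h2⟩ := h.inner_commutator hA hn B φ ψ
    have e : ∀ s : ℝ, fhat f s * ∫ u in (0 : ℝ)..s, commForm A B
        ⟨expI A (-(s - u)) φ, expI_mem_domain hA _ φ⟩ ⟨expI A u ψ, expI_mem_domain hA u ψ⟩
        = -Complex.I * (fhat f s * inner ℂ (φ : H) (B (expI A s ψ) - expI A s (B ψ))) := fun s => by
      rw [hI _ _ (inner_commutator_expI hA B (expI_mem_domain hA) φ ψ s)]
      ring
    refine ⟨fun s => (continuous_commForm_expI hA B (expI_mem_domain hA) φ ψ
      s).intervalIntegrable _ _, ?_, ?_⟩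
    · rw [funext e]
      exact h1.const_mul _
    · rw [funext e, integral_const_mul, h2, ← mul_assoc, mul_neg, Complex.I_mul_I, neg_neg, one_mul]
  · have hT : IsCommutator A B (ad A B 1) := isCommutator_ad hB1 one_pos
    obtain ⟨h1, h2⟩ := h.commutator_apply hA hn hT ψ
    have e : ∀ s : ℝ, fhat f s • ∫ u in (0 : ℝ)..s, expI A (s - u) (ad A B 1 (expI A u ψ))
        = -Complex.I • (fhat f s • (B (expI A s ψ) - expI A s (B ψ))) := fun s => by
      rw [commutator_expI_apply hA hT, smul_comm (-Complex.I), smul_smul (-Complex.I), neg_mul,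
        Complex.I_mul_I, neg_neg, one_smul]
    refine ⟨fun s => (continuous_expI_comp_expI hA (ad A B 1) ψ s).intervalIntegrable _ _, ?_, ?_⟩
    · rw [funext e]
      exact h1.smul _
    · rw [funext e, integral_smul, h2, smul_smul, mul_neg, Complex.I_mul_I, neg_neg, one_smul]
  · refine ⟨expansionRemainder A B n f, expansionRemainder A B n fun x => star (f x), ?_,
      h.commutator_eq_sub_adjoint hA hB hBn, fun hreal => ?_,
      h.norm_expansionRemainder_le hA hn hBn, ?_⟩
    · rw [expansionRemainder, add_sub_cancel]
    · congr 1
      ext x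
      exact Complex.conj_eq_iff_im.mpr (hreal x)
    · have h1 := h.conj.norm_expansionRemainder_le hA hn hBn
      have h2 : ∫ s : ℝ, ‖star (fhat f (-s))‖ * |s| ^ n = ∫ s : ℝ, ‖fhat f s‖ * |s| ^ n := by
        rw [← integral_neg_eq_self fun s : ℝ => ‖fhat f s‖ * |s| ^ n]
        simp
      rwa [h2] at h1
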